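/- **Theorem 2 (Pointwise MDP for the Nadaraya–Watson kernel estimator).** Let $d,q\ge 1$ and let $(X_i,Y_i)_{i\ge1}$ be independent, identically distributed $\mathbb R^d\times\mathbb R^q$-valued random variables with joint probability density $f(t,y)$ and $\mathbb E\|Y_1\|<\infty$. Put $g(t)=\int_{\mathbb R^q} f(t,y)\,dy$, $m(t)=\int_{\mathbb R^q} y f(t,y)\,dy$ and $r(t)=\mathbb E(Y\mid X=t)=m(t)/g(t)$. Let $K:\mathbb R^d\to\mathbb R$ be a measurable function, $(h_n)$ a positive sequence with $h_n\to0$ and $nh_n^d\to\infty$, and $(v_n)$ a positive sequence. Let $$m_n(x)=\frac1{nh_n^d}\sum_{i=1}^n Y_iK\Big(\frac{x-X_i}{h_n}\Big),\qquad g_n(x)=\frac1{nh_n^d}\sum_{i=1}^n K\Big(\frac{x-X_i}{h_n}\Big),$$ and let $r_n(x)=m_n(x)/g_n(x)$ if $g_n(x)\ne0$, $r_n(x)=0$ otherwise. Fix $x\in\mathbb R^d$ and assume: * (A1) $K$ is bounded and integrable, $\int_{\mathbb R^d} K(z)\,dz=1$ and $\lim_{\|z\|\to\infty}K(z)=0$.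 * (A2) For every $u\in\mathbb R^q$, the function $t\mapsto\int_{\mathbb R^q}e^{\langle u,y\rangle}f(t,y)\,dy$ is finite and bounded on $\mathbb R^d$, and continuous at $x$. * (A3) For every $u\in\mathbb R^q$, the functions $t\mapsto\int\langle u,y\rangle^2f(t,y)\,dy$ and $t\mapsto\int\langle u,y\rangle f(t,y)\,dy$ are continuous at $x$, and $g(x)\ne0$. * (A4) $v_n\to\infty$ and $nh_n^d/v_n^2\to\infty$. * (A5) There is an integer $p\ge2$ such that: (i) for all $s\in\{1,\dots,p-1\}$ and $j\in\{1,\dots,d\}$, $\int_{\mathbb R}y_j^sK(y)\,dy_j=0$ (integration over the $j$-th coordinate only, for almost all values of the other coordinates) and $\int_{\mathbb R^d}|y_j^pK(y)|\,dy<\infty$; (ii) $v_nh_n^p\to0$; (iii) $m$ and $g$ are $p$ times differentiable on $\mathbb R^d$, and their differentials of order $p$ are bounded on $\mathbb R^d$ and continuous at $x$. Let $\Sigma_x=\mathrm{Var}(Y\mid X=x)$ be the covariance matrix of the conditional density $f(x,\cdot)/g(x)$, and for $w\in\mathbb R^q$ put $$G_x(w)=\frac{g(x)}{2\int_{\mathbb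 R^d}K^2(z)\,dz}\;w^T\Sigma_x^{-1}w .$$ Then $G_x$ is a good rate function (lower semicontinuous with values in $[0,\infty]$, with compact level sets $\{G_x\le\alpha\}$, $\alpha<\infty$), and the sequence $\big(v_n(r_n(x)-r(x))\big)$ satisfies a large deviations principle with speed $nh_n^d/v_n^2$ and rate function $G_x$: for every open $U\subset\mathbb R^q$ and every closed $V\subset\mathbb R^q$, $$\liminf_{n\to\infty}\frac{v_n^2}{nh_n^d}\log\mathbb P\big[v_n(r_n(x)-r(x))\in U\big]\ge-\inf_{w\in U}G_x(w),\qquad \limsup_{n\to\infty}\frac{v_n^2}{nh_n^d}\log\mathbb P\big[v_n(r_n(x)-r(x))\in V\big]\le-\inf_{w\in V}G_x(w).$$ -/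

import Mathlib

open MeasureTheory ProbabilityTheory Filter Topology
open scoped ENNReal NNReal Matrix

noncomputable section

/-- A speed: a sequence (indexed by the integers `n ≥ 1`) of positive numbers tending to infinity. -/
def IsSpeed (ν : ℕ → ℝ) : Prop :=
  (∀ n, 1 ≤ n → 0 < ν n) ∧ Tendsto ν atTop atTop

/-- A good rate function: lower semicontinuous, with values in `[0, ∞]`, with compact level sets. -/
def IsGoodRateFunction {E : Type*} [TopologicalSpace E] (I : E → ℝ≥0∞) : Prop :=
  LowerSemicontinuous I ∧ ∀ α : ℝ≥0, IsCompact {s : E | I s ≤ (α : ℝ≥0∞)}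

/-- The sequence `Z` satisfies a large deviations principle with speed `ν` and rate `I`.
All quantities live in `[-∞, ∞]`, with `log 0 = -∞` and `inf ∅ = ∞`. -/
def SatisfiesLDP {Ω : Type*} [MeasurableSpace Ω] (P : Measure Ω)
    {E : Type*} [TopologicalSpace E] (Z : ℕ → Ω → E) (ν : ℕ → ℝ) (I : E → ℝ≥0∞) : Prop :=
  IsSpeed ν ∧
  (∀ U : Set E, IsOpen U →
    -((⨅ s ∈ U, I s : ℝ≥0∞) : EReal) ≤
      liminf (fun n => (((ν n)⁻¹ : ℝ) : EReal) * ENNReal.log (P {ω | Z n ω ∈ U})) atTop) ∧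
  (∀ V : Set E, IsClosed V →
    limsup (fun n => (((ν n)⁻¹ : ℝ) : EReal) * ENNReal.log (P {ω | Z n ω ∈ V})) atTop ≤
      -((⨅ s ∈ V, I s : ℝ≥0∞) : EReal))

variable {d q : ℕ}

/-- The marginal density `g(t) = ∫ f(t,y) dy` of `X`. -/
def marginalDensity (f : EuclideanSpace ℝ (Fin d) → EuclideanSpace ℝ (Fin q) → ℝ)
    (t : EuclideanSpace ℝ (Fin d)) : ℝ :=
  ∫ y, f t y

/-- `m(t) = ∫ y f(t,y) dy`. -/
def unnormalizedRegression (f : EuclideanSpace ℝ (Fin d) → EuclideanSpace ℝ (Fin q) → ℝ)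
    (t : EuclideanSpace ℝ (Fin d)) : EuclideanSpace ℝ (Fin q) :=
  ∫ y, f t y • y

/-- The regression function `r(t) = E(Y | X = t) = m(t) / g(t)`. -/
def regression (f : EuclideanSpace ℝ (Fin d) → EuclideanSpace ℝ (Fin q) → ℝ)
    (t : EuclideanSpace ℝ (Fin d)) : EuclideanSpace ℝ (Fin q) :=
  (marginalDensity f t)⁻¹ • unnormalizedRegression f t

/-- The conditional covariance matrix `Σ_t = Var(Y | X = t)`, the covariance matrix of the
conditional density `y ↦ f(t,y) / g(t)`. -/
def condCovariance (f : EuclideanSpace ℝ (Fin d) → EuclideanSpace ℝ (Fin q) → ℝ)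
    (t : EuclideanSpace ℝ (Fin d)) : Matrix (Fin q) (Fin q) ℝ :=
  Matrix.of fun i j =>
    (∫ y, (y i - regression f t i) * (y j - regression f t j) * f t y) / marginalDensity f t

/-- The quadratic rate function `G_x(v) = g(x) / (2 ∫ K²) * vᵀ Σ_x⁻¹ v`. -/
def quadraticRate (K : EuclideanSpace ℝ (Fin d) → ℝ)
    (f : EuclideanSpace ℝ (Fin d) → EuclideanSpace ℝ (Fin q) → ℝ)
    (x : EuclideanSpace ℝ (Fin d)) (v : EuclideanSpace ℝ (Fin q)) : ℝ≥0∞ :=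
  ENNReal.ofReal (marginalDensity f x / (2 * ∫ z, K z ^ 2) *
    (v.ofLp ⬝ᵥ ((condCovariance f x)⁻¹ *ᵥ v.ofLp)))

variable {Ω : Type*}

/-- The kernel density estimator `g_n(x)`; the observations are `X 0, …, X (n-1)`. -/
def densityEstimator (K : EuclideanSpace ℝ (Fin d) → ℝ) (h : ℕ → ℝ)
    (X : ℕ → Ω → EuclideanSpace ℝ (Fin d)) (n : ℕ) (x : EuclideanSpace ℝ (Fin d)) (ω : Ω) : ℝ :=
  ((n : ℝ) * h n ^ d)⁻¹ * ∑ i ∈ Finset.range n, K ((h n)⁻¹ • (x - X i ω))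

/-- The numerator `m_n(x)` of the Nadaraya-Watson estimator. -/
def numeratorEstimator (K : EuclideanSpace ℝ (Fin d) → ℝ) (h : ℕ → ℝ)
    (X : ℕ → Ω → EuclideanSpace ℝ (Fin d)) (Y : ℕ → Ω → EuclideanSpace ℝ (Fin q))
    (n : ℕ) (x : EuclideanSpace ℝ (Fin d)) (ω : Ω) : EuclideanSpace ℝ (Fin q) :=
  ((n : ℝ) * h n ^ d)⁻¹ • ∑ i ∈ Finset.range n, K ((h n)⁻¹ • (x - X i ω)) • Y i ω

open Classical in
/-- The Nadaraya-Watson estimator `r_n(x)`: it is `m_n(x) / g_n(x)` if `g_n(x) ≠ 0`,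
and `0` otherwise. -/
def nadarayaWatson (K : EuclideanSpace ℝ (Fin d) → ℝ) (h : ℕ → ℝ)
    (X : ℕ → Ω → EuclideanSpace ℝ (Fin d)) (Y : ℕ → Ω → EuclideanSpace ℝ (Fin q))
    (n : ℕ) (x : EuclideanSpace ℝ (Fin d)) (ω : Ω) : EuclideanSpace ℝ (Fin q) :=
  if densityEstimator K h X n x ω ≠ 0 then
    (densityEstimator K h X n x ω)⁻¹ • numeratorEstimator K h X Y n x ω
  else 0

/-- Kernel moment condition of order `p`: for `1 ≤ s ≤ p - 1` and every coordinate `j`, the partial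
integral `∫ y_j^s K(y) dy_j` (over the `j`-th coordinate alone) vanishes, for almost all values of
the other coordinates, and `y_j^p K(y)` is integrable over the whole space. -/
def HasKernelOrder (K : EuclideanSpace ℝ (Fin d) → ℝ) (p : ℕ) : Prop :=
  (∀ s : ℕ, 1 ≤ s → s ≤ p - 1 → ∀ j : Fin d, ∀ᵐ y : EuclideanSpace ℝ (Fin d),
    ∫ a : ℝ, a ^ s * K (WithLp.toLp 2 (Function.update y.ofLp j a)) = 0) ∧
  (∀ j : Fin d, Integrable (fun y : EuclideanSpace ℝ (Fin d) => y j ^ p * K y))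

/-- `φ` is `p` times (Fréchet) differentiable on the whole space, and its differential of order `p`
is bounded and continuous at `x`. -/
def HasBoundedDifferential {E F : Type*} [NormedAddCommGroup E] [NormedSpace ℝ E]
    [NormedAddCommGroup F] [NormedSpace ℝ F] (φ : E → F) (p : ℕ) (x : E) : Prop :=
  (∀ k : ℕ, k < p → Differentiable ℝ (iteratedFDeriv ℝ k φ)) ∧
  (∃ C : ℝ, ∀ t, ‖iteratedFDeriv ℝ p φ t‖ ≤ C) ∧
  ContinuousAt (iteratedFDeriv ℝ p φ) x

end

/-! Where `g_n(x) ≠ 0`, the normalised error factors exactly: `v_n (r_n - r) = (g / g_n) • W_n`,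
with `W_n = (v_n / g) • (m_n - g_n • r)` and `g`, `r` evaluated at `x`. The vector `W_n` is linear
in the data, so `⟪u, W_n⟫` is a normalised sum of i.i.d. terms, kernel times an affine function of
`Y` (`inner_numeratorEstimator_sub`), and its moment generating function is an `n`-th power.

A second order expansion of one factor (`exists_mgf_kernel_expansion`) gives a linear term, a
quadratic term and a cubic remainder. The linear term is a kernel-smoothed mean; its bias is `O(h_n
^ p)` because the intermediate moments of `K` vanish (`HasKernelOrder.norm_bias_le`), hence
negligible against `1 / v_n`. The quadratic term is an approximate identity with kernel `K ^ 2`. At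
speed `n h_n ^ d / v_n ^ 2` the logarithmic moment generating function of `W_n` therefore converges
to `(∫ K ^ 2) / (2 g) * uᵀ Σ_x u` (`eventually_mgf_kernelSum_bounds`).

The same expansion with the constant weights `±1`, together with `v_n → ∞`, shows that a fixed
deviation of `g_n` from `g` is superexponentially unlikely. Hence the factor `g / g_n` is within any
`δ` of `1` up to negligible events (`isSuperexponentialRescaling_nadarayaWatson`). Both
Gärtner–Ellis bounds are proved directly for such a rescaled sequence
(`eventually_measureReal_closed_le`, `eventually_le_measureReal_open`). The limit is a finite
quadratic form and `Σ_x` is positive definite (`condCovariance_posDef`), so every point is a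
gradient of the limit and the rate is the dual quadratic form (`satisfiesLDP_quadratic`). -/

/-- The scaled logarithmic moment generating functions `(ν n)⁻¹ log E exp (ν n ⟪u, W n⟫)` are
eventually finite and converge pointwise to `L`. -/
def HasScaledLogMGF {Ω : Type*} [MeasurableSpace Ω] (P : Measure Ω) {E : Type*}
    [NormedAddCommGroup E] [InnerProductSpace ℝ E] (W : ℕ → Ω → E) (ν : ℕ → ℝ) (L : E → ℝ) :
    Prop :=
  ∀ u : E, ∀ ε : ℝ, 0 < ε → ∀ᶠ n in atTop,
    Integrable (fun ω => Real.exp (ν n * inner ℝ u (W n ω))) P ∧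
    Real.exp (ν n * (L u - ε)) ≤ ∫ ω, Real.exp (ν n * inner ℝ u (W n ω)) ∂P ∧
    ∫ ω, Real.exp (ν n * inner ℝ u (W n ω)) ∂P ≤ Real.exp (ν n * (L u + ε))

/-- `Z n` is a random multiple of `W n`, the factor being close to `1` outside of an event whose
probability decays faster than any exponential at speed `ν`. -/
def IsSuperexponentialRescaling {Ω : Type*} [MeasurableSpace Ω] (P : Measure Ω) {E : Type*}
    [NormedAddCommGroup E] [InnerProductSpace ℝ E] (W Z : ℕ → Ω → E) (ν : ℕ → ℝ) : Prop :=
  ∀ δ : ℝ, 0 < δ → ∀ M : ℝ, ∀ᶠ n in atTop,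
    P.real {ω | ¬ ∃ τ : ℝ, |τ - 1| ≤ δ ∧ Z n ω = τ • W n ω} ≤ Real.exp (-(ν n * M))

/-! ### Exponential rates: absorbing constants, and passing from real bounds to extended logarithms.
-/

lemma eventually_const_mul_exp_le {ν : ℕ → ℝ} (hν : Tendsto ν atTop atTop) (C : ℝ) {a b : ℝ}
    (hab : b < a) : ∀ᶠ n in atTop, C * Real.exp (-(ν n * a)) ≤ Real.exp (-(ν n * b)) := by
  have h1 : Tendsto (fun n => Real.exp (ν n * (a - b))) atTop atTop :=
    Real.tendsto_exp_atTop.comp (hν.atTop_mul_const (sub_pos.2 hab))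
  filter_upwards [h1.eventually_ge_atTop C] with n hn
  calc C * Real.exp (-(ν n * a)) ≤ Real.exp (ν n * (a - b)) * Real.exp (-(ν n * a)) := by gcongr
    _ = _ := by rw [← Real.exp_add]; congr 1; ring

section EReal

variable {Ω : Type*} [MeasurableSpace Ω] {P : Measure Ω} [IsProbabilityMeasure P]
  {S : ℕ → Set Ω} {ν : ℕ → ℝ}

lemma limsup_scaled_log_le (hν : Tendsto ν atTop atTop) {c : ℝ}
    (h : ∀ᶠ n in atTop, P.real (S n) ≤ Real.exp (-(ν n * c))) :
    limsup (fun n => (((ν n)⁻¹ : ℝ) : EReal) * ENNReal.log (P (S n))) atTop ≤ ((-c : ℝ) : EReal) := by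
  refine limsup_le_of_le (by isBoundedDefault) ?_
  filter_upwards [h, hν.eventually_gt_atTop 0] with n hn hpos
  have h1 : P (S n) ≤ ENNReal.ofReal (Real.exp (-(ν n * c))) := by
    rw [← ofReal_measureReal (μ := P) (s := S n)]
    exact ENNReal.ofReal_le_ofReal hn
  have h2 := ENNReal.log_le_log h1
  rw [ENNReal.log_ofReal_of_pos (Real.exp_pos _), Real.log_exp] at h2
  calc _ ≤ (((ν n)⁻¹ : ℝ) : EReal) * ((-(ν n * c) : ℝ) : EReal) :=
        mul_le_mul_of_nonneg_left h2 (by exact_mod_cast (inv_pos.2 hpos).le)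
    _ = _ := by
      rw [← EReal.coe_mul]; congr 1; field_simp

lemma le_liminf_scaled_log (hν : Tendsto ν atTop atTop) {c : ℝ}
    (h : ∀ᶠ n in atTop, Real.exp (-(ν n * c)) ≤ P.real (S n)) :
    ((-c : ℝ) : EReal) ≤
      liminf (fun n => (((ν n)⁻¹ : ℝ) : EReal) * ENNReal.log (P (S n))) atTop := by
  refine le_liminf_of_le (by isBoundedDefault) ?_
  filter_upwards [h, hν.eventually_gt_atTop 0] with n hn hpos
  have h1 : ENNReal.ofReal (Real.exp (-(ν n * c))) ≤ P (S n) := by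
    rw [← ofReal_measureReal (μ := P) (s := S n)]
    exact ENNReal.ofReal_le_ofReal hn
  have h2 := ENNReal.log_le_log h1
  rw [ENNReal.log_ofReal_of_pos (Real.exp_pos _), Real.log_exp] at h2
  calc _ = (((ν n)⁻¹ : ℝ) : EReal) * ((-(ν n * c) : ℝ) : EReal) := by
        rw [← EReal.coe_mul]; congr 1; field_simp
    _ ≤ _ := mul_le_mul_of_nonneg_left h2 (by exact_mod_cast (inv_pos.2 hpos).le)

end EReal

/-! ### Gärtner–Ellis bounds for a randomly rescaled sequence. -/

section GartnerEllis

variable {Ω : Type*} [MeasurableSpace Ω] {P : Measure Ω} {q : ℕ}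
  {W Z : ℕ → Ω → EuclideanSpace ℝ (Fin q)} {ν : ℕ → ℝ} {L : EuclideanSpace ℝ (Fin q) → ℝ}

/-- This is Chernoff's bound under the law tilted by `u₀`, before division by the normalising
constant. The tilted logarithmic moment generating function is `L (u₀ + ·) - L u₀`, so any larger
level `c` is exceeded with exponentially small tilted probability. -/
lemma eventually_exp_mul_integral_le {u₀ u : EuclideanSpace ℝ (Fin q)} {c C : ℝ} (hC : 0 < C)
    (hν : Tendsto ν atTop atTop) (hL : HasScaledLogMGF P W ν L) (hc : L (u₀ + u) - L u₀ < c) :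
    ∀ᶠ n in atTop, Integrable (fun ω => Real.exp (ν n * (inner ℝ (u₀ + u) (W n ω) - c))) P ∧
      ∫ ω, Real.exp (ν n * (inner ℝ (u₀ + u) (W n ω) - c)) ∂P ≤
        C * ∫ ω, Real.exp (ν n * inner ℝ u₀ (W n ω)) ∂P := by
  obtain ⟨η, hη, hηc⟩ : ∃ η : ℝ, 0 < η ∧ L (u₀ + u) + η - c < L u₀ - η :=
    ⟨(c - L (u₀ + u) + L u₀) / 3, by linarith, by linarith⟩
  filter_upwards [hL (u₀ + u) η hη, hL u₀ η hη, eventually_const_mul_exp_le hν C⁻¹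
    (show -(L u₀ - η) < -(L (u₀ + u) + η - c) by linarith)] with n h1 h2 h3
  have heq : (fun ω => Real.exp (ν n * (inner ℝ (u₀ + u) (W n ω) - c))) =
      fun ω => Real.exp (-(ν n * c)) * Real.exp (ν n * inner ℝ (u₀ + u) (W n ω)) := by
    funext ω; rw [← Real.exp_add]; congr 1; ring
  rw [heq]
  refine ⟨h1.1.const_mul _, ?_⟩
  rw [integral_const_mul]
  calc _ ≤ Real.exp (-(ν n * c)) * Real.exp (ν n * (L (u₀ + u) + η)) := by gcongr; exact h1.2.2
    _ = C * (C⁻¹ * Real.exp (-(ν n * -(L (u₀ + u) + η - c)))) := by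
        rw [← mul_assoc, mul_inv_cancel₀ hC.ne', one_mul, ← Real.exp_add]; congr 1; ring
    _ ≤ C * Real.exp (-(ν n * -(L u₀ - η))) := by gcongr
    _ = C * Real.exp (ν n * (L u₀ - η)) := by congr 2; ring
    _ ≤ _ := by gcongr; exact h2.2.1

variable [IsProbabilityMeasure P]

lemma eventually_measureReal_halfSpace_le (hν : Tendsto ν atTop atTop)
    (hL : HasScaledLogMGF P W ν L) (u : EuclideanSpace ℝ (Fin q)) {c l : ℝ} (hc : l + L u < c) :
    ∀ᶠ n in atTop, P.real {ω | c < inner ℝ u (W n ω)} ≤ Real.exp (-(ν n * l)) := by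
  filter_upwards [hL u (c - L u - l) (by linarith), hν.eventually_gt_atTop 0] with n hn hpos
  obtain ⟨hi, -, hle⟩ := hn
  have h1 := measure_ge_le_exp_mul_mgf (μ := P) (X := fun ω => inner ℝ u (W n ω)) c hpos.le hi
  calc P.real {ω | c < inner ℝ u (W n ω)} ≤ P.real {ω | c ≤ inner ℝ u (W n ω)} :=
        measureReal_mono (Set.ofPred_subset_ofPred.2 fun ω hω => le_of_lt hω)
    _ ≤ _ := h1
    _ ≤ Real.exp (-ν n * c) * Real.exp (ν n * (L u + (c - L u - l))) := by
        gcongr; exact hle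
    _ = _ := by rw [← Real.exp_add]; congr 1; ring

lemma eventually_measureReal_rescaled_halfSpace_le (hν : Tendsto ν atTop atTop)
    (hL : HasScaledLogMGF P W ν L) (hZ : IsSuperexponentialRescaling P W Z ν)
    (u : EuclideanSpace ℝ (Fin q)) {c l : ℝ} (hc0 : 0 ≤ c) (hc : l + L u < c) :
    ∀ᶠ n in atTop, P.real {ω | c < inner ℝ u (Z n ω)} ≤ Real.exp (-(ν n * l)) := by
  obtain ⟨η, hη, hηc⟩ : ∃ η : ℝ, 0 < η ∧ l + η + L u < c - η :=
    ⟨(c - l - L u) / 3, by linarith, by linarith⟩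
  -- The bound `c * δ ≤ η` yields `(1 + δ) * (c - η) ≤ c`, so a factor `τ ≤ 1 + δ` cannot carry a
  -- value at most `c - η` above `c`. The bound `1 / 2` keeps `τ` positive, and `c + 1` avoids
  -- dividing by zero.
  set δ : ℝ := min (1 / 2) (η / (c + 1)) with hδ
  have hδ0 : 0 < δ := lt_min (by norm_num) (by positivity)
  have hδ1 : δ ≤ 1 / 2 := min_le_left _ _
  have hδc : c * δ ≤ η := by
    have h1 : δ ≤ η / (c + 1) := min_le_right _ _
    rw [le_div_iff₀ (by linarith)] at h1
    nlinarith
  filter_upwards [hZ δ hδ0 (l + η), eventually_measureReal_halfSpace_le hν hL u hηc,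
    eventually_const_mul_exp_le hν 2 (show l < l + η by linarith)] with n h1 h2 h3
  calc P.real {ω | c < inner ℝ u (Z n ω)}
      ≤ P.real ({ω | ¬ ∃ τ : ℝ, |τ - 1| ≤ δ ∧ Z n ω = τ • W n ω} ∪
          {ω | c - η < inner ℝ u (W n ω)}) := by
        refine measureReal_mono (fun ω hω => ?_)
        by_cases hτ : ∃ τ : ℝ, |τ - 1| ≤ δ ∧ Z n ω = τ • W n ω
        · right
          obtain ⟨τ, hτ1, hτ2⟩ := hτ
          rw [Set.mem_ofPred_eq, hτ2, inner_smul_right] at hω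
          rw [abs_le] at hτ1
          have hpos : 0 < τ := by linarith
          rw [Set.mem_ofPred_eq]
          have hs : 0 < inner ℝ u (W n ω) := by
            by_contra hcon
            push Not at hcon
            nlinarith
          by_contra hcon
          push Not at hcon
          have : τ * inner ℝ u (W n ω) ≤ (1 + δ) * (c - η) := by
            have := mul_le_mul (show τ ≤ 1 + δ by linarith) hcon hs.le (by linarith)
            exact this
          nlinarith
        · left; exact hτ
    _ ≤ _ := measureReal_union_le _ _
    _ ≤ Real.exp (-(ν n * (l + η))) + Real.exp (-(ν n * (l + η))) := add_le_add h1 h2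
    _ ≤ _ := by linarith

/-- A closed set all of whose points are separated from the origin by affine functions
`⟪u, ·⟫ - L u - l` is covered by finitely many of the corresponding half-spaces. -/
lemma exists_finset_halfSpace_cover {V : Set (EuclideanSpace ℝ (Fin q))} (hV : IsClosed V) (l : ℝ)
    (L : EuclideanSpace ℝ (Fin q) → ℝ) (h : ∀ w ∈ V, ∃ u, l + L u < inner ℝ u w) :
    ∃ s : Finset (EuclideanSpace ℝ (Fin q)), ∀ w ∈ V, ∃ u ∈ s, l + L u < inner ℝ u w := by
  classical
  let H : EuclideanSpace ℝ (Fin q) → Set (EuclideanSpace ℝ (Fin q)) :=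
    fun u => {w | l + L u < inner ℝ u w}
  have hH : ∀ u, IsOpen (H u) := fun u => isOpen_lt continuous_const (by fun_prop)
  -- The half-spaces in the directions `±e_i` leave only a bounded box uncovered, so that
  -- compactness applies to the rest of `V`. This takes the place of exponential tightness.
  let s₀ : Finset (EuclideanSpace ℝ (Fin q)) :=
    (Finset.univ.image fun i => EuclideanSpace.single i (1 : ℝ)) ∪
      (Finset.univ.image fun i => EuclideanSpace.single i (-1 : ℝ))
  let C : Set (EuclideanSpace ℝ (Fin q)) := V \ ⋃ u ∈ s₀, H u
  have hCclosed : IsClosed C := hV.sdiff (isOpen_biUnion fun u _ => hH u)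
  have hCbdd : Bornology.IsBounded C := by
    have hK : IsCompact (WithLp.toLp 2 '' (Set.Icc
        (fun i => -(l + L (EuclideanSpace.single i (-1 : ℝ))))
        (fun i => l + L (EuclideanSpace.single i (1 : ℝ))) : Set (Fin q → ℝ))) :=
      isCompact_Icc.image (PiLp.continuous_toLp 2 _)
    refine hK.isBounded.subset fun w hw => ⟨w.ofLp, ⟨fun i => ?_, fun i => ?_⟩, rfl⟩
    · by_contra hcon
      push Not at hcon
      refine hw.2 (Set.mem_biUnion (x := EuclideanSpace.single i (-1 : ℝ))
        (by simp [s₀]) ?_)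
      simp only [H, Set.mem_ofPred_eq, EuclideanSpace.inner_single_left]
      simp; linarith
    · by_contra hcon
      push Not at hcon
      refine hw.2 (Set.mem_biUnion (x := EuclideanSpace.single i (1 : ℝ))
        (by simp [s₀]) ?_)
      simp only [H, Set.mem_ofPred_eq, EuclideanSpace.inner_single_left]
      simp; linarith
  have hCcomp : IsCompact C := Metric.isCompact_of_isClosed_isBounded hCclosed hCbdd
  obtain ⟨s₁, hs₁⟩ := hCcomp.elim_finite_subcover H hH
    (fun w hw => Set.mem_iUnion.2 (h w hw.1))
  refine ⟨s₀ ∪ s₁, fun w hw => ?_⟩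
  by_cases hw0 : w ∈ ⋃ u ∈ s₀, H u
  · obtain ⟨u, hu, hwu⟩ := Set.mem_iUnion₂.1 hw0
    exact ⟨u, Finset.mem_union_left _ hu, hwu⟩
  · obtain ⟨u, hu, hwu⟩ := Set.mem_iUnion₂.1 (hs₁ ⟨hw, hw0⟩)
    exact ⟨u, Finset.mem_union_right _ hu, hwu⟩

/-- Upper bound of the Gärtner–Ellis theorem. -/
theorem eventually_measureReal_closed_le (hν : Tendsto ν atTop atTop)
    (hL : HasScaledLogMGF P W ν L) (hL0 : ∀ u, 0 ≤ L u)
    (hZ : IsSuperexponentialRescaling P W Z ν)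
    {V : Set (EuclideanSpace ℝ (Fin q))} (hV : IsClosed V) {l l' : ℝ} (hl : 0 ≤ l) (hl' : l' < l)
    (h : ∀ w ∈ V, ∃ u, l + L u < inner ℝ u w) :
    ∀ᶠ n in atTop, P.real {ω | Z n ω ∈ V} ≤ Real.exp (-(ν n * l')) := by
  obtain ⟨s, hs⟩ := exists_finset_halfSpace_cover hV l L h
  obtain ⟨l₁, h1, h2⟩ := exists_between hl'
  have hev : ∀ᶠ n in atTop, ∀ u ∈ s,
      P.real {ω | l + L u < inner ℝ u (Z n ω)} ≤ Real.exp (-(ν n * l₁)) := by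
    rw [Finset.eventually_all]
    intro u _
    exact eventually_measureReal_rescaled_halfSpace_le hν hL hZ u
      (add_nonneg hl (hL0 u)) (by linarith)
  filter_upwards [hev, eventually_const_mul_exp_le hν s.card h1] with n hn hn2
  calc P.real {ω | Z n ω ∈ V} ≤ P.real (⋃ u ∈ s, {ω | l + L u < inner ℝ u (Z n ω)}) := by
        refine measureReal_mono (fun ω hω => ?_) (measure_ne_top _ _)
        obtain ⟨u, hu, h3⟩ := hs _ hω
        exact Set.mem_biUnion hu h3
    _ ≤ ∑ u ∈ s, P.real {ω | l + L u < inner ℝ u (Z n ω)} := measureReal_biUnion_finset_le _ _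
    _ ≤ ∑ u ∈ s, Real.exp (-(ν n * l₁)) := Finset.sum_le_sum hn
    _ = s.card * Real.exp (-(ν n * l₁)) := by simp
    _ ≤ _ := hn2

/-- Lower bound of the Gärtner–Ellis theorem at a point `w₀` which is the gradient of `L`. -/
theorem eventually_le_measureReal_open (hν : Tendsto ν atTop atTop)
    (hL : HasScaledLogMGF P W ν L) (hW : ∀ n, Measurable (W n))
    (hZ : IsSuperexponentialRescaling P W Z ν)
    {u₀ w₀ : EuclideanSpace ℝ (Fin q)}
    (hgrad : ∀ e, ∀ ρ > 0, ∃ s > 0, L (u₀ + s • e) - L u₀ - s * inner ℝ e w₀ < s * ρ)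
    {U : Set (EuclideanSpace ℝ (Fin q))} (hU : IsOpen U) (hw₀ : w₀ ∈ U) {ε : ℝ} (hε : 0 < ε) :
    ∀ᶠ n in atTop,
      Real.exp (-(ν n * (inner ℝ u₀ w₀ - L u₀ + 3 * ε))) ≤ P.real {ω | Z n ω ∈ U} := by
  -- Joint continuity of `(τ, w) ↦ τ • w` at `(1, w₀)` lets one radius control both the random
  -- factor and the position of `W n`.
  obtain ⟨ρ, hρ, hρU⟩ : ∃ ρ > 0, ∀ (τ : ℝ) (w : EuclideanSpace ℝ (Fin q)), |τ - 1| < ρ →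
      (∀ i, |w i - w₀ i| < ρ) → τ • w ∈ U ∧ inner ℝ u₀ w < inner ℝ u₀ w₀ + ε := by
    let F : ℝ × (Fin q → ℝ) → EuclideanSpace ℝ (Fin q) := fun z => z.1 • WithLp.toLp 2 z.2
    have hcont : Continuous fun z : ℝ × (Fin q → ℝ) => (WithLp.toLp 2 z.2 : EuclideanSpace ℝ (Fin q)) :=
      (PiLp.continuous_toLp 2 _).comp continuous_snd
    have hF : Continuous F := continuous_fst.smul hcont
    have hopen : IsOpen (F ⁻¹' U ∩ {z : ℝ × (Fin q → ℝ) |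
        inner ℝ u₀ (WithLp.toLp 2 z.2 : EuclideanSpace ℝ (Fin q)) < inner ℝ u₀ w₀ + ε}) :=
      (hU.preimage hF).inter (isOpen_lt (continuous_const.inner hcont) continuous_const)
    obtain ⟨ρ, hρ, hb⟩ := Metric.isOpen_iff.1 hopen (1, w₀.ofLp)
      ⟨by simpa [F] using hw₀, by simpa using hε⟩
    refine ⟨ρ, hρ, fun τ w h1 h2 => ?_⟩
    have : (τ, w.ofLp) ∈ Metric.ball ((1 : ℝ), w₀.ofLp) ρ := by
      rw [Metric.mem_ball, Prod.dist_eq, max_lt_iff]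
      exact ⟨by rwa [Real.dist_eq], (dist_pi_lt_iff hρ).2 fun i => by rw [Real.dist_eq]; exact h2 i⟩
    exact hb this
  let e : Fin q × Bool → EuclideanSpace ℝ (Fin q) :=
    fun j => EuclideanSpace.single j.1 (if j.2 then (1 : ℝ) else -1)
  choose s hs hsρ using fun j => hgrad (e j) ρ hρ
  -- Each of the `2q` side terms is to be at most this inverse fraction of the total mass, so that
  -- together they take at most half of it. The `+ 1` covers `q = 0`.
  have hcard : (0 : ℝ) < 2 * ((Fintype.card (Fin q × Bool) : ℝ) + 1) := by positivity
  have hev : ∀ᶠ n in atTop, ∀ j,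
      Integrable (fun ω => Real.exp (ν n * (inner ℝ (u₀ + s j • e j) (W n ω)
        - s j * (inner ℝ (e j) w₀ + ρ)))) P ∧
      ∫ ω, Real.exp (ν n * (inner ℝ (u₀ + s j • e j) (W n ω)
        - s j * (inner ℝ (e j) w₀ + ρ))) ∂P ≤
        (2 * ((Fintype.card (Fin q × Bool) : ℝ) + 1))⁻¹ *
          ∫ ω, Real.exp (ν n * inner ℝ u₀ (W n ω)) ∂P := by
    rw [eventually_all]
    exact fun j => eventually_exp_mul_integral_le (inv_pos.2 hcard) hν hL
      (by nlinarith [hsρ j])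
  set I₀ : ℝ := inner ℝ u₀ w₀ - L u₀ with hI₀
  filter_upwards [hev, hL u₀ ε hε, hZ (ρ / 2) (half_pos hρ) (I₀ + 3 * ε), hν.eventually_gt_atTop 0,
    eventually_const_mul_exp_le hν 4 (show I₀ + 2 * ε < I₀ + 3 * ε by linarith)]
    with n hn hu0 hbad hpos h4
  let B : Set Ω := {ω | ∀ i, |W n ω i - w₀ i| < ρ}
  have hB : MeasurableSet B := by
    have : B = ⋂ i, {ω | |W n ω i - w₀ i| < ρ} := by ext; simp [B]
    rw [this]
    refine MeasurableSet.iInter fun i => measurableSet_lt ?_ measurable_const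
    have := hW n
    fun_prop
  set M : ℝ := ∫ ω, Real.exp (ν n * inner ℝ u₀ (W n ω)) ∂P with hM
  -- The change of measure is done pointwise, without building the tilted law. On the box `B` the
  -- exponential is at most a constant. Off `B` some direction `±e_i` exceeds its mean by `ρ`, and
  -- the corresponding extra tilt `s j • e j` only increases the exponential.
  have hpt : ∀ ω, Real.exp (ν n * inner ℝ u₀ (W n ω)) ≤
      B.indicator (fun _ => Real.exp (ν n * (inner ℝ u₀ w₀ + ε))) ω +
      ∑ j, Real.exp (ν n * (inner ℝ (u₀ + s j • e j) (W n ω)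
        - s j * (inner ℝ (e j) w₀ + ρ))) := by
    intro ω
    by_cases hω : ω ∈ B
    · rw [Set.indicator_of_mem hω]
      have h1 := (hρU 1 (W n ω) (by simpa using hρ) hω).2
      have h2 : (0 : ℝ) ≤ ∑ j, Real.exp (ν n * (inner ℝ (u₀ + s j • e j) (W n ω)
        - s j * (inner ℝ (e j) w₀ + ρ))) := Finset.sum_nonneg fun j _ => (Real.exp_pos _).le
      have h3 : Real.exp (ν n * inner ℝ u₀ (W n ω)) ≤ Real.exp (ν n * (inner ℝ u₀ w₀ + ε)) := by
        gcongr
      linarith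
    · rw [Set.indicator_of_notMem hω, zero_add]
      simp only [B, Set.mem_ofPred_eq, not_forall, not_lt] at hω
      obtain ⟨i, hi⟩ := hω
      obtain ⟨j, hj⟩ : ∃ j, inner ℝ (e j) w₀ + ρ ≤ inner ℝ (e j) (W n ω) := by
        rcases le_abs'.1 hi with h | h
        · refine ⟨(i, false), ?_⟩
          simp [e, EuclideanSpace.inner_single_left]; linarith
        · refine ⟨(i, true), ?_⟩
          simp [e, EuclideanSpace.inner_single_left]; linarith
      refine le_trans ?_ (Finset.single_le_sum (f := fun j =>
        Real.exp (ν n * (inner ℝ (u₀ + s j • e j) (W n ω) - s j * (inner ℝ (e j) w₀ + ρ))))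
        (fun j _ => (Real.exp_pos _).le) (Finset.mem_univ j))
      refine Real.exp_le_exp.2 (mul_le_mul_of_nonneg_left ?_ hpos.le)
      rw [inner_add_left, real_inner_smul_left]
      nlinarith [hs j]
  have hint : M ≤ P.real B * Real.exp (ν n * (inner ℝ u₀ w₀ + ε)) + M / 2 := by
    have hi1 : Integrable (B.indicator fun _ => Real.exp (ν n * (inner ℝ u₀ w₀ + ε))) P :=
      (integrable_const _).indicator hB
    have hi2 : Integrable (fun ω => ∑ j, Real.exp (ν n * (inner ℝ (u₀ + s j • e j) (W n ω)
        - s j * (inner ℝ (e j) w₀ + ρ)))) P := integrable_finsetSum _ fun j _ => (hn j).1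
    have hM0 : 0 ≤ M := integral_nonneg fun _ => (Real.exp_pos _).le
    calc M ≤ _ := integral_mono hu0.1 (hi1.add hi2) hpt
      _ = P.real B * Real.exp (ν n * (inner ℝ u₀ w₀ + ε)) + ∑ j,
          ∫ ω, Real.exp (ν n * (inner ℝ (u₀ + s j • e j) (W n ω)
            - s j * (inner ℝ (e j) w₀ + ρ))) ∂P := by
        simp only [Pi.add_apply]
        rw [integral_add hi1 hi2, integral_indicator hB, integral_finsetSum _ fun j _ => (hn j).1]
        simp
      _ ≤ P.real B * Real.exp (ν n * (inner ℝ u₀ w₀ + ε)) +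
          ∑ j : Fin q × Bool, (2 * ((Fintype.card (Fin q × Bool) : ℝ) + 1))⁻¹ * M := by
        gcongr with j _
        exact (hn j).2
      _ ≤ _ := by
        rw [Finset.sum_const, Finset.card_univ, nsmul_eq_mul, ← mul_assoc]
        have : (Fintype.card (Fin q × Bool) : ℝ) * (2 * ((Fintype.card (Fin q × Bool) : ℝ) + 1))⁻¹
            ≤ 1 / 2 := by
          rw [← div_eq_mul_inv, div_le_div_iff₀ hcard (by norm_num)]; linarith
        nlinarith
  have hPB : 1 / 2 * Real.exp (-(ν n * (I₀ + 2 * ε))) ≤ P.real B := by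
    have h1 : Real.exp (ν n * (L u₀ - ε)) / 2 ≤
        P.real B * Real.exp (ν n * (inner ℝ u₀ w₀ + ε)) := by linarith [hu0.2.1]
    have h2 : Real.exp (-(ν n * (I₀ + 2 * ε))) * Real.exp (ν n * (inner ℝ u₀ w₀ + ε)) =
        Real.exp (ν n * (L u₀ - ε)) := by
      rw [← Real.exp_add]; congr 1; rw [hI₀]; ring
    refine le_of_mul_le_mul_right ?_ (Real.exp_pos (ν n * (inner ℝ u₀ w₀ + ε)))
    rw [mul_assoc, h2]; linarith
  have hsub : P.real B ≤ P.real {ω | Z n ω ∈ U} +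
      P.real {ω | ¬ ∃ τ : ℝ, |τ - 1| ≤ ρ / 2 ∧ Z n ω = τ • W n ω} := by
    refine (measureReal_mono (fun ω hω => ?_)).trans (measureReal_union_le _ _)
    by_cases hτ : ∃ τ : ℝ, |τ - 1| ≤ ρ / 2 ∧ Z n ω = τ • W n ω
    · obtain ⟨τ, h1, h2⟩ := hτ
      left
      rw [Set.mem_ofPred_eq, h2]
      exact (hρU τ _ (by linarith) hω).1
    · right; exact hτ
  -- `P(B)` is at least half of the rate-`2ε` exponential, hence at least twice the rate-`3ε` one by
  -- the factor `4` in `h4`. The bad event costs one copy, and one is left.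
  linarith

end GartnerEllis

/-! ### Taylor's inequality with a bounded top differential. -/

section Taylor

variable {E F : Type*} [NormedAddCommGroup E] [NormedSpace ℝ E] [NormedAddCommGroup F]
  [NormedSpace ℝ F]

/-- The derivative of a Taylor remainder is the remainder, one order lower, of the shifted chain `k
↦ D (k + 1)`; induction and the mean value inequality on `[0, 1]` finish. No continuity of `D p`
enters, as it would for an integral remainder. The price is the missing factor `1 / p!`, which is
irrelevant here. -/
lemma norm_sub_taylor_sum_le {D : ℕ → ℝ → F} {p : ℕ} {B : ℝ} (hB : 0 ≤ B)
    (hD : ∀ k < p, ∀ s, HasDerivAt (D k) (D (k + 1) s) s) (hb : ∀ s, ‖D p s‖ ≤ B) :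
    ∀ s ∈ Set.Icc (0 : ℝ) 1,
      ‖D 0 s - ∑ k ∈ Finset.range p, (s ^ k / k.factorial) • D k 0‖ ≤ B := by
  induction p generalizing D with
  | zero => intro s _; simpa using hb s
  | succ p ih =>
    intro s hs
    have ih' := ih (D := fun k => D (k + 1)) (fun k hk => hD (k + 1) (by omega)) hb
    have hder : ∀ s, HasDerivAt
        (fun s => D 0 s - ∑ k ∈ Finset.range (p + 1), (s ^ k / k.factorial) • D k 0)
        (D 1 s - ∑ k ∈ Finset.range p, (s ^ k / k.factorial) • D (k + 1) 0) s := by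
      intro s
      refine (hD 0 (by omega) s).sub ?_
      simp_rw [Finset.sum_range_succ']
      have h2 : ∀ k ∈ Finset.range p, HasDerivAt
          (fun s : ℝ => (s ^ (k + 1) / (k + 1).factorial) • D (k + 1) 0)
          ((s ^ k / k.factorial) • D (k + 1) 0) s := by
        intro k _
        refine HasDerivAt.smul_const ?_ _
        convert (hasDerivAt_pow (k + 1) s).div_const ((k + 1).factorial : ℝ) using 1
        have : (k.factorial : ℝ) ≠ 0 := by positivity
        rw [Nat.factorial_succ]
        push_cast
        field_simp
      simpa using (HasDerivAt.fun_sum h2).add_const (D 0 0)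
    have hmv := norm_image_sub_le_of_norm_deriv_le_segment' (a := 0) (b := 1) (C := B)
      (fun s _ => (hder s).hasDerivWithinAt) (fun s hs => ih' s ⟨hs.1, hs.2.le⟩) s hs
    have h0 : D 0 0 - ∑ k ∈ Finset.range (p + 1), ((0 : ℝ) ^ k / k.factorial) • D k 0 = 0 := by
      simp [Finset.sum_range_succ']
    rw [h0, sub_zero] at hmv
    nlinarith [hs.2]

/-- Taylor's inequality for a function whose differential of order `p` exists and is bounded. -/
lemma norm_sub_iteratedFDeriv_sum_le {φ : E → F} {p : ℕ} {B : ℝ}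
    (hφ : ∀ k < p, Differentiable ℝ (iteratedFDeriv ℝ k φ))
    (hB : ∀ t, ‖iteratedFDeriv ℝ p φ t‖ ≤ B) (x z : E) :
    ‖φ (x + z) - ∑ k ∈ Finset.range p,
      ((k.factorial : ℝ)⁻¹) • iteratedFDeriv ℝ k φ x (fun _ => z)‖ ≤ B * ‖z‖ ^ p := by
  have hD : ∀ k < p, ∀ s : ℝ, HasDerivAt
      (fun s : ℝ => iteratedFDeriv ℝ k φ (x + s • z) (fun _ => z))
      (iteratedFDeriv ℝ (k + 1) φ (x + s • z) (fun _ => z)) s := by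
    intro k hk s
    have h1 : HasDerivAt (fun s : ℝ => x + s • z) z s := by
      simpa using ((hasDerivAt_id s).smul_const z).const_add x
    have h2 := ((hφ k hk) (x + s • z)).hasFDerivAt.comp_hasDerivAt s h1
    have h3 := (ContinuousMultilinearMap.apply ℝ (fun _ : Fin k => E) F
      (fun _ => z)).hasFDerivAt.comp_hasDerivAt s h2
    exact h3
  have hb : ∀ s : ℝ, ‖iteratedFDeriv ℝ p φ (x + s • z) (fun _ => z)‖ ≤ B * ‖z‖ ^ p := by
    intro s
    refine ((iteratedFDeriv ℝ p φ (x + s • z)).le_opNorm _).trans ?_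
    simp only [Finset.prod_const, Finset.card_univ, Fintype.card_fin]
    gcongr
    exact hB _
  have hB0 : 0 ≤ B * ‖z‖ ^ p := (norm_nonneg _).trans (hb 0)
  simpa using norm_sub_taylor_sum_le
    (D := fun k s => iteratedFDeriv ℝ k φ (x + s • z) (fun _ => z)) hB0 hD hb 1 (by simp)

end Taylor

/-! ### Kernels of order `p`: moments and bias. -/

lemma integral_eq_zero_of_integral_update_eq_zero {d : ℕ} {G : EuclideanSpace ℝ (Fin d) → ℝ}
    (hG : Integrable G) (j : Fin d)
    (h : ∀ᵐ y : EuclideanSpace ℝ (Fin d),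
      ∫ a : ℝ, G (WithLp.toLp 2 (Function.update y.ofLp j a)) = 0) : ∫ z, G z = 0 := by
  cases d with
  | zero => exact j.elim0
  | succ n =>
    let e : EuclideanSpace ℝ (Fin (n + 1)) ≃ᵐ ℝ × (Fin n → ℝ) :=
      (MeasurableEquiv.toLp 2 (Fin (n + 1) → ℝ)).symm.trans
        (MeasurableEquiv.piFinSuccAbove (fun _ => ℝ) j)
    have he : MeasurePreserving e volume volume :=
      (volume_preserving_piFinSuccAbove (fun _ => ℝ) j).comp (PiLp.volume_preserving_ofLp _)
    have hes := he.symm e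
    have hsymm : ∀ a y, e.symm (a, y) = WithLp.toLp 2 (j.insertNth a y) := fun a y => rfl
    rw [← hes.integral_comp e.symm.measurableEmbedding G, Measure.volume_eq_prod,
      integral_prod_symm (fun z => G (e.symm z))
      ((hes.integrable_comp_emb e.symm.measurableEmbedding).2 hG)]
    have hae := hes.quasiMeasurePreserving.ae h
    rw [Measure.volume_eq_prod] at hae
    -- The partial integral does not depend on the `j`-th coordinate, which `Function.update`
    -- overwrites. One good value `b` of that coordinate therefore gives the statement for almost
    -- all values of the others.
    obtain ⟨b, hb⟩ := (Measure.ae_ae_of_ae_prod hae).exists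
    refine integral_eq_zero_of_ae ?_
    filter_upwards [hb] with y hy
    simp only [hsymm] at hy ⊢
    simpa [Fin.update_insertNth] using hy

section Kernel

variable {d : ℕ} {K : EuclideanSpace ℝ (Fin d) → ℝ} {p : ℕ}

/-- The kernel condition only controls pure powers of coordinates. The `ℓ¹` bound on the norm and
the power mean inequality turn these into a moment of the norm. -/
lemma HasKernelOrder.integrable_norm_pow_mul (hK : HasKernelOrder K p) (hKm : Measurable K)
    (hp : 1 ≤ p) : Integrable fun z => ‖z‖ ^ p * |K z| := by
  obtain ⟨n, rfl⟩ : ∃ n, p = n + 1 := ⟨p - 1, by omega⟩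
  have hint : Integrable fun z : EuclideanSpace ℝ (Fin d) =>
      ∑ j, (d : ℝ) ^ n * ‖z j ^ (n + 1) * K z‖ :=
    integrable_finsetSum _ fun j _ => ((hK.2 j).norm).const_mul _
  refine hint.mono' (by fun_prop) (ae_of_all _ fun z => ?_)
  have h1 : ‖z‖ ≤ ∑ j, |z j| := by
    conv_lhs => rw [← (EuclideanSpace.basisFun (Fin d) ℝ).sum_repr z]
    refine (norm_sum_le _ _).trans (Finset.sum_le_sum fun j _ => ?_)
    simp [norm_smul]
  have h2 : (∑ j, |z j|) ^ (n + 1) ≤ (d : ℝ) ^ n * ∑ j, |z j| ^ (n + 1) := by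
    rcases Nat.eq_zero_or_pos d with rfl | hd
    · simp
    have h3 := pow_sum_div_card_le_sum_pow (s := Finset.univ) (f := fun j => |z j|)
      (fun j _ => abs_nonneg _) n
    rw [div_le_iff₀ (by simp; positivity)] at h3
    simpa [mul_comm] using h3
  rw [Real.norm_of_nonneg (by positivity)]
  calc ‖z‖ ^ (n + 1) * |K z| ≤ ((d : ℝ) ^ n * ∑ j, |z j| ^ (n + 1)) * |K z| := by
        gcongr
        exact (pow_le_pow_left₀ (norm_nonneg _) h1 _).trans h2
    _ = _ := by
        rw [mul_assoc, Finset.sum_mul, Finset.mul_sum]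
        simp

lemma HasKernelOrder.integrable_norm_pow_mul_of_le (hK : HasKernelOrder K p) (hKm : Measurable K)
    (hKi : Integrable K) (hp : 1 ≤ p) {k : ℕ} (hk : k ≤ p) :
    Integrable fun z => ‖z‖ ^ k * |K z| := by
  refine (hKi.abs.add (hK.integrable_norm_pow_mul hKm hp)).mono' (by fun_prop)
    (ae_of_all _ fun z => ?_)
  rw [Real.norm_of_nonneg (by positivity)]
  have h1 : ‖z‖ ^ k ≤ 1 + ‖z‖ ^ p := by
    rcases le_total ‖z‖ 1 with h | h
    · have := pow_le_one₀ (n := k) (norm_nonneg z) h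
      have : 0 ≤ ‖z‖ ^ p := by positivity
      linarith
    · have := pow_le_pow_right₀ h hk
      linarith
  calc _ ≤ (1 + ‖z‖ ^ p) * |K z| := by gcongr
    _ = _ := by simp only [Pi.add_apply]; ring

lemma HasKernelOrder.integrable_mul_prod (hK : HasKernelOrder K p) (hKm : Measurable K)
    (hKi : Integrable K) (hp : 1 ≤ p) {k : ℕ} (hk : k ≤ p) (r : Fin k → Fin d) :
    Integrable fun z : EuclideanSpace ℝ (Fin d) => K z * ∏ i, z (r i) := by
  refine (hK.integrable_norm_pow_mul_of_le hKm hKi hp hk).mono' (by fun_prop)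
    (ae_of_all _ fun z => ?_)
  rw [norm_mul, mul_comm, Real.norm_eq_abs (K z), norm_prod]
  gcongr
  calc ∏ i, ‖z (r i)‖ ≤ ∏ _i : Fin k, ‖z‖ := by
        gcongr with i _
        exact PiLp.norm_apply_le z (r i)
    _ = _ := by simp

/-- A coordinate `j` occurring in a monomial of degree `k < p` has exponent between `1` and `p - 1`.
Integrating in that coordinate first, with the others frozen, already gives zero, so mixed moments
vanish too. -/
lemma HasKernelOrder.integral_mul_prod_eq_zero (hK : HasKernelOrder K p) (hKm : Measurable K)
    (hKi : Integrable K) {k : ℕ} (hk0 : k ≠ 0) (hk : k < p) (r : Fin k → Fin d) :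
    ∫ z : EuclideanSpace ℝ (Fin d), K z * ∏ i, z (r i) = 0 := by
  have : NeZero k := ⟨hk0⟩
  let j := r 0
  let s := (Finset.univ.filter fun i => r i = j).card
  have hs1 : 1 ≤ s := Finset.card_pos.2 ⟨0, by simp [j]⟩
  have hs2 : s ≤ p - 1 := by
    have : s ≤ k := (Finset.card_le_univ _).trans (by simp)
    omega
  refine integral_eq_zero_of_integral_update_eq_zero
    (hK.integrable_mul_prod hKm hKi (by omega) hk.le r) j ?_
  filter_upwards [hK.1 s hs1 hs2 j] with y hy
  have hprod : ∀ a : ℝ, ∏ i, Function.update y.ofLp j a (r i) =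
      a ^ s * ∏ i ∈ Finset.univ.filter (fun i => ¬ r i = j), y (r i) := by
    intro a
    rw [← Finset.prod_filter_mul_prod_filter_not Finset.univ (fun i => r i = j)]
    congr 1
    · rw [Finset.prod_congr rfl (g := fun _ => a), Finset.prod_const]
      intro i hi
      rw [(Finset.mem_filter.1 hi).2, Function.update_self]
    · refine Finset.prod_congr rfl fun i hi => ?_
      rw [Function.update_of_ne (Finset.mem_filter.1 hi).2]
  simp only [hprod]
  calc _ = ∫ a : ℝ, (∏ i ∈ Finset.univ.filter (fun i => ¬ r i = j), y (r i)) *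
        (a ^ s * K (WithLp.toLp 2 (Function.update y.ofLp j a))) := by
        congr 1; funext a; ring
    _ = 0 := by rw [integral_const_mul, hy, mul_zero]

variable {F : Type*} [NormedAddCommGroup F] [NormedSpace ℝ F]

lemma map_const_eq_sum_prod_smul {k : ℕ} (T : ContinuousMultilinearMap ℝ
    (fun _ : Fin k => EuclideanSpace ℝ (Fin d)) F) (z : EuclideanSpace ℝ (Fin d)) :
    T (fun _ => z) = ∑ r : Fin k → Fin d,
      (∏ i, z (r i)) • T (fun i => EuclideanSpace.basisFun (Fin d) ℝ (r i)) := by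
  conv_lhs => rw [← (EuclideanSpace.basisFun (Fin d) ℝ).sum_repr z]
  rw [ContinuousMultilinearMap.map_sum]
  refine Finset.sum_congr rfl fun r _ => ?_
  rw [ContinuousMultilinearMap.map_smul_univ]
  simp

lemma HasKernelOrder.integral_smul_multilinear [CompleteSpace F] (hK : HasKernelOrder K p) (hKm : Measurable K)
    (hKi : Integrable K) {k : ℕ} (hk : k < p) (T : ContinuousMultilinearMap ℝ
    (fun _ : Fin k => EuclideanSpace ℝ (Fin d)) F) :
    Integrable (fun z => K z • T (fun _ => z)) ∧
      (k ≠ 0 → ∫ z, K z • T (fun _ => z) = 0) := by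
  have heq : (fun z => K z • T (fun _ => z)) = fun z => ∑ r : Fin k → Fin d,
      (K z * ∏ i, z (r i)) • T (fun i => EuclideanSpace.basisFun (Fin d) ℝ (r i)) := by
    funext z
    rw [map_const_eq_sum_prod_smul, Finset.smul_sum]
    simp [mul_smul]
  have hint := fun r : Fin k → Fin d => hK.integrable_mul_prod hKm hKi (by omega) hk.le r
  rw [heq]
  refine ⟨integrable_finsetSum _ fun r _ => (hint r).smul_const _, fun hk0 => ?_⟩
  rw [integral_finsetSum _ fun r _ => (hint r).smul_const _]
  refine Finset.sum_eq_zero fun r _ => ?_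
  rw [integral_smul_const, hK.integral_mul_prod_eq_zero hKm hKi hk0 hk, zero_smul]

/-- The bias of a kernel of order `p` is of order `h ^ p`. -/
theorem HasKernelOrder.norm_bias_le [CompleteSpace F] (hK : HasKernelOrder K p)
    (hKm : Measurable K) (hKi : Integrable K) (hK1 : ∫ z, K z = 1) (hp : 1 ≤ p)
    {φ : EuclideanSpace ℝ (Fin d) → F}
    {x : EuclideanSpace ℝ (Fin d)} (hφ : HasBoundedDifferential φ p x) :
    ∃ C : ℝ, ∀ h : ℝ, (Integrable fun z => K z • φ (x - h • z)) →
      ‖(∫ z, K z • φ (x - h • z)) - φ x‖ ≤ C * |h| ^ p := by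
  obtain ⟨hd, ⟨B, hB⟩, -⟩ := hφ
  refine ⟨B * ∫ z, ‖z‖ ^ p * |K z|, fun h hint => ?_⟩
  -- `S` is the Taylor polynomial of `φ` at `x` in the increment `-(h • z)`. Integrated against `K`,
  -- only its constant term survives, so the whole bias is the integrated remainder.
  let S : EuclideanSpace ℝ (Fin d) → F := fun z => ∑ k ∈ Finset.range p,
    ((k.factorial : ℝ)⁻¹) • iteratedFDeriv ℝ k φ x (fun _ => -(h • z))
  have hSk : ∀ k z, K z • iteratedFDeriv ℝ k φ x (fun _ => -(h • z)) =
      (-h) ^ k • K z • iteratedFDeriv ℝ k φ x (fun _ => z) := by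
    intro k z
    have : (fun _ : Fin k => -(h • z)) = fun i => (fun _ => -h) i • (fun _ => z) i := by
      funext i; simp
    rw [this, ContinuousMultilinearMap.map_smul_univ, smul_comm]
    simp
  have hSeq : (fun z => K z • S z) = fun z => ∑ k ∈ Finset.range p,
      ((k.factorial : ℝ)⁻¹ * (-h) ^ k) • K z • iteratedFDeriv ℝ k φ x (fun _ => z) := by
    funext z
    simp only [S, Finset.smul_sum]
    refine Finset.sum_congr rfl fun k _ => ?_
    rw [smul_comm, hSk, mul_smul]
  have hterm := fun k (hk : k ∈ Finset.range p) => hK.integral_smul_multilinear hKm hKi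
    (Finset.mem_range.1 hk) (iteratedFDeriv ℝ k φ x)
  have hterm' : ∀ k ∈ Finset.range p, Integrable fun z =>
      ((k.factorial : ℝ)⁻¹ * (-h) ^ k) • K z • iteratedFDeriv ℝ k φ x (fun _ => z) :=
    fun k hk => (hterm k hk).1.smul _
  have hSint : Integrable fun z => K z • S z := by
    rw [hSeq]
    exact integrable_finsetSum _ hterm'
  have hSval : ∫ z, K z • S z = φ x := by
    rw [hSeq, integral_finsetSum _ hterm',
      Finset.sum_eq_single_of_mem 0 (by simp; omega)]
    · simp only [integral_smul]
      simp [integral_smul_const, hK1]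
    · intro k hk hk0
      rw [integral_smul, (hterm k hk).2 hk0, smul_zero]
  rw [← hSval, ← integral_sub hint hSint]
  have hbound : Integrable fun z => B * |h| ^ p * (‖z‖ ^ p * |K z|) :=
    (hK.integrable_norm_pow_mul hKm hp).const_mul _
  calc _ ≤ ∫ z, B * |h| ^ p * (‖z‖ ^ p * |K z|) := by
        refine norm_integral_le_of_norm_le hbound (ae_of_all _ fun z => ?_)
        rw [← smul_sub, norm_smul, Real.norm_eq_abs]
        have := norm_sub_iteratedFDeriv_sum_le hd hB x (-(h • z))
        rw [norm_neg, norm_smul, mul_pow, ← sub_eq_add_neg, Real.norm_eq_abs] at this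
        calc _ ≤ |K z| * (B * (|h| ^ p * ‖z‖ ^ p)) := by gcongr
          _ = _ := by ring
    _ = _ := by rw [integral_const_mul]; ring

end Kernel

/-! ### Elementary exponential inequalities. -/

lemma Real.abs_exp_sub_taylor_two_le (s : ℝ) :
    |Real.exp s - (1 + s + s ^ 2 / 2)| ≤ |s| ^ 3 * Real.exp |s| := by
  have h := Complex.norm_exp_sub_sum_le_norm_mul_exp (s : ℂ) 3
  simp only [Finset.sum_range_succ, Finset.sum_range_zero] at h
  rw [Complex.norm_real, Real.norm_eq_abs] at h
  convert h using 1
  rw [← Real.norm_eq_abs, ← Complex.norm_real]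
  push_cast
  simp

/-- From `log (1 + s) ≥ s / (1 + s)`, the claim reduces to `s ^ 2 * (1 + 2 * s) ≥ 0`. It serves to
bound the `n`-th power of a moment generating function from below. -/
lemma Real.exp_sub_two_mul_sq_le {s : ℝ} (hs : -(1 / 2) ≤ s) :
    Real.exp (s - 2 * s ^ 2) ≤ 1 + s := by
  have hpos : 0 < 1 + s := by linarith
  rw [← Real.le_log_iff_exp_le hpos]
  refine le_trans ?_ (Real.one_sub_inv_le_log_of_pos hpos)
  have h1 : 1 - (1 + s)⁻¹ = s / (1 + s) := by field_simp; ring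
  rw [h1, le_div_iff₀ hpos]
  nlinarith [mul_nonneg (sq_nonneg s) (show 0 ≤ 1 + 2 * s by linarith)]

/-! ### Weights in `y` integrated uniformly against `f t`. -/

section WeightedIntegrals

variable {d q : ℕ} {f : EuclideanSpace ℝ (Fin d) → EuclideanSpace ℝ (Fin q) → ℝ}

/-- The weight `χ` is integrable against every `f t`, and its absolute integrals are uniformly
bounded. -/
structure IsBoundedlyIntegrable (f : EuclideanSpace ℝ (Fin d) → EuclideanSpace ℝ (Fin q) → ℝ)
    (χ : EuclideanSpace ℝ (Fin q) → ℝ) : Prop where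
  measurable : Measurable χ
  integrable : ∀ t, Integrable fun y => χ y * f t y
  bounded : ∃ C : ℝ, ∀ t, ∫ y, |χ y| * f t y ≤ C

lemma IsBoundedlyIntegrable.mono {χ χ' : EuclideanSpace ℝ (Fin q) → ℝ}
    (hf_meas : Measurable (Function.uncurry f)) (hf_nonneg : ∀ t y, 0 ≤ f t y)
    (h : IsBoundedlyIntegrable f χ) (hm : Measurable χ') {A : ℝ} (hA : 0 ≤ A)
    (hle : ∀ y, |χ' y| ≤ A * |χ y|) : IsBoundedlyIntegrable f χ' := by
  have habs : ∀ t, Integrable fun y => |χ y| * f t y := fun t => by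
    refine (h.integrable t).abs.congr (ae_of_all _ fun y => ?_)
    simp only [abs_mul, abs_of_nonneg (hf_nonneg t y)]
  have hint : ∀ t, Integrable fun y => χ' y * f t y := fun t => by
    have hft : Measurable (f t) := hf_meas.of_uncurry_left
    refine ((habs t).const_mul A).mono' (by fun_prop) (ae_of_all _ fun y => ?_)
    rw [norm_mul, Real.norm_eq_abs, Real.norm_of_nonneg (hf_nonneg t y), ← mul_assoc]
    exact mul_le_mul_of_nonneg_right (hle y) (hf_nonneg t y)
  refine ⟨hm, hint, ?_⟩
  obtain ⟨C, hC⟩ := h.bounded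
  refine ⟨A * C, fun t => ?_⟩
  calc ∫ y, |χ' y| * f t y ≤ ∫ y, A * (|χ y| * f t y) := by
        refine integral_mono ?_ ((habs t).const_mul A) fun y => ?_
        · refine (hint t).abs.congr (ae_of_all _ fun y => ?_)
          simp only [abs_mul, abs_of_nonneg (hf_nonneg t y)]
        · simp only [← mul_assoc]
          exact mul_le_mul_of_nonneg_right (hle y) (hf_nonneg t y)
    _ = A * ∫ y, |χ y| * f t y := integral_const_mul _ _
    _ ≤ _ := by gcongr; exact hC t

lemma IsBoundedlyIntegrable.abs_integral_le {χ : EuclideanSpace ℝ (Fin q) → ℝ}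
    (hf_nonneg : ∀ t y, 0 ≤ f t y) (h : IsBoundedlyIntegrable f χ) :
    ∃ C : ℝ, ∀ t, |∫ y, χ y * f t y| ≤ C := by
  obtain ⟨C, hC⟩ := h.bounded
  refine ⟨C, fun t => le_trans (abs_integral_le_integral_abs.trans (le_of_eq ?_)) (hC t)⟩
  simp only [abs_mul, abs_of_nonneg (hf_nonneg t _)]

/-- Affine functions have uniformly bounded exponential moments. -/
lemma isBoundedlyIntegrable_exp_abs_affine
    (hf_meas : Measurable (Function.uncurry f)) (hf_nonneg : ∀ t y, 0 ≤ f t y)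
    (hfin : ∀ (u : EuclideanSpace ℝ (Fin q)) (t : EuclideanSpace ℝ (Fin d)),
      Integrable (fun y => Real.exp (inner ℝ u y) * f t y))
    (hbdd : ∀ u : EuclideanSpace ℝ (Fin q), ∃ C : ℝ, ∀ t : EuclideanSpace ℝ (Fin d),
      ∫ y, Real.exp (inner ℝ u y) * f t y ≤ C)
    (a c : ℝ) (hc : 0 ≤ c) (u : EuclideanSpace ℝ (Fin q)) :
    IsBoundedlyIntegrable f fun y => Real.exp (c * |a + inner ℝ u y|) := by
  obtain ⟨C₁, hC₁⟩ := hbdd (c • u)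
  obtain ⟨C₂, hC₂⟩ := hbdd (-(c • u))
  -- Since `exp |s| ≤ exp s + exp (-s)`, exponential moments in the two directions `±c • u` suffice.
  have h1 : IsBoundedlyIntegrable f fun y =>
      Real.exp (inner ℝ (c • u) y) + Real.exp (inner ℝ (-(c • u)) y) := by
    refine ⟨by fun_prop, fun t => ?_, C₁ + C₂, fun t => ?_⟩
    · simp only [add_mul]
      exact (hfin _ t).add (hfin _ t)
    · have : ∀ y : EuclideanSpace ℝ (Fin q),
          |Real.exp (inner ℝ (c • u) y) + Real.exp (inner ℝ (-(c • u)) y)| =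
          Real.exp (inner ℝ (c • u) y) + Real.exp (inner ℝ (-(c • u)) y) :=
        fun y => abs_of_pos (by positivity)
      simp only [this, add_mul]
      rw [integral_add (hfin _ t) (hfin _ t)]
      exact add_le_add (hC₁ t) (hC₂ t)
  refine h1.mono hf_meas hf_nonneg (by fun_prop) (Real.exp_pos (c * |a|)).le fun y => ?_
  have hsum : |Real.exp (inner ℝ (c • u) y) + Real.exp (inner ℝ (-(c • u)) y)| =
      Real.exp (inner ℝ (c • u) y) + Real.exp (inner ℝ (-(c • u)) y) := abs_of_pos (by positivity)
  rw [abs_of_pos (Real.exp_pos _), hsum, mul_add (Real.exp _), ← Real.exp_add, ← Real.exp_add, inner_neg_left, real_inner_smul_left]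
  have h2 : c * |a + inner ℝ u y| ≤ c * |a| + c * |inner ℝ u y| := by
    rw [← mul_add]; gcongr; exact abs_add_le _ _
  rcases le_total 0 (inner ℝ u y) with h | h
  · rw [abs_of_nonneg h] at h2
    have := Real.exp_le_exp.2 h2
    have := Real.exp_pos (c * |a| + -(c * inner ℝ u y))
    linarith
  · rw [abs_of_nonpos h, mul_neg] at h2
    have := Real.exp_le_exp.2 h2
    have := Real.exp_pos (c * |a| + c * inner ℝ u y)
    linarith

lemma stronglyMeasurable_integral_mul {χ : EuclideanSpace ℝ (Fin q) → ℝ} (hχ : Measurable χ)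
    (hf_meas : Measurable (Function.uncurry f)) :
    StronglyMeasurable fun t => ∫ y, χ y * f t y := by
  refine StronglyMeasurable.integral_prod_right (f := fun t y => χ y * f t y) ?_
  exact ((hχ.comp measurable_snd).mul hf_meas).stronglyMeasurable

end WeightedIntegrals

/-! ### Approximate identities at a continuity point. -/

section ApproximateIdentity

variable {d : ℕ} {κ φ : EuclideanSpace ℝ (Fin d) → ℝ} {x : EuclideanSpace ℝ (Fin d)}

lemma integrable_kernel_mul (hκ : Integrable κ) (hφ : StronglyMeasurable φ) {C : ℝ}
    (hC : ∀ t, |φ t| ≤ C) (h : ℝ) : Integrable fun z => κ z * φ (x - h • z) := by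
  refine hκ.mul_bdd (c := C) ?_ (ae_of_all _ fun z => hC _)
  exact (hφ.comp_measurable (by fun_prop)).aestronglyMeasurable

lemma tendsto_integral_kernel_mul (hκ : Integrable κ) (hφ : StronglyMeasurable φ) {C : ℝ}
    (hC : ∀ t, |φ t| ≤ C) (hx : ContinuousAt φ x) {h : ℕ → ℝ} (hh : Tendsto h atTop (𝓝 0)) :
    Tendsto (fun n => ∫ z, κ z * φ (x - h n • z)) atTop (𝓝 ((∫ z, κ z) * φ x)) := by
  rw [← integral_mul_const]
  refine tendsto_integral_of_dominated_convergence (fun z => |κ z| * C)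
    (fun n => (integrable_kernel_mul hκ hφ hC _).aestronglyMeasurable) (hκ.abs.mul_const C)
    (fun n => ae_of_all _ fun z => ?_) (ae_of_all _ fun z => ?_)
  · rw [norm_mul]
    exact mul_le_mul_of_nonneg_left (hC _) (abs_nonneg _)
  · refine Tendsto.const_mul _ ?_
    refine hx.tendsto.comp ?_
    simpa using (tendsto_const_nhds (x := x)).sub (hh.smul_const z)

end ApproximateIdentity

/-! ### Moments and exponential moments of a single kernel term. -/

section KernelExpectation

variable {Ω : Type*} [MeasurableSpace Ω] {P : Measure Ω} {d q : ℕ}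
  {f : EuclideanSpace ℝ (Fin d) → EuclideanSpace ℝ (Fin q) → ℝ}
  {X : Ω → EuclideanSpace ℝ (Fin d)} {Y : Ω → EuclideanSpace ℝ (Fin q)}

/-- Expectations of kernel weights, after the change of variables `t = x - h • z`. -/
lemma integral_kernel_mul_weight (hX : Measurable X) (hY : Measurable Y)
    (hf_meas : Measurable (Function.uncurry f)) (hf_nonneg : ∀ t y, 0 ≤ f t y)
    (hlaw : P.map (fun ω => (X ω, Y ω)) =
      (volume : Measure (EuclideanSpace ℝ (Fin d) × EuclideanSpace ℝ (Fin q))).withDensity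
        (fun z => ENNReal.ofReal (f z.1 z.2)))
    {κ : EuclideanSpace ℝ (Fin d) → ℝ} (hκm : Measurable κ) (hκ : Integrable κ)
    {χ : EuclideanSpace ℝ (Fin q) → ℝ} (hχ : IsBoundedlyIntegrable f χ)
    (x : EuclideanSpace ℝ (Fin d)) {h : ℝ} (hh : 0 < h) :
    Integrable (fun ω => κ (h⁻¹ • (x - X ω)) * χ (Y ω)) P ∧
      ∫ ω, κ (h⁻¹ • (x - X ω)) * χ (Y ω) ∂P =
        h ^ d * ∫ z, κ z * ∫ y, χ y * f (x - h • z) y := by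
  have hχm := hχ.measurable
  let G : EuclideanSpace ℝ (Fin d) × EuclideanSpace ℝ (Fin q) → ℝ :=
    fun z => κ (h⁻¹ • (x - z.1)) * χ z.2
  have hG : Measurable G := by
    have h1 : Measurable fun z : EuclideanSpace ℝ (Fin d) × EuclideanSpace ℝ (Fin q) =>
      κ (h⁻¹ • (x - z.1)) := hκm.comp (by fun_prop)
    exact h1.mul (hχm.comp measurable_snd)
  have hdens : Measurable fun z : EuclideanSpace ℝ (Fin d) × EuclideanSpace ℝ (Fin q) =>
      ENNReal.ofReal (f z.1 z.2) := hf_meas.ennreal_ofReal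
  have hXY : Measurable fun ω => (X ω, Y ω) := hX.prodMk hY
  have hsm : ∀ z : EuclideanSpace ℝ (Fin d) × EuclideanSpace ℝ (Fin q),
      (ENNReal.ofReal (f z.1 z.2)).toReal • G z =
        κ (h⁻¹ • (x - z.1)) * (χ z.2 * f z.1 z.2) := fun z => by
    rw [ENNReal.toReal_ofReal (hf_nonneg _ _), smul_eq_mul]; simp only [G]; ring
  have hκx : Integrable fun t => κ (h⁻¹ • (x - t)) :=
    Integrable.comp_sub_left
      ((integrable_comp_smul_iff volume κ (inv_ne_zero hh.ne')).2 hκ) x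
  obtain ⟨C, hC⟩ := hχ.bounded
  have hmeas : Measurable fun z : EuclideanSpace ℝ (Fin d) × EuclideanSpace ℝ (Fin q) =>
      κ (h⁻¹ • (x - z.1)) * (χ z.2 * f z.1 z.2) := by
    have h1 : Measurable fun z : EuclideanSpace ℝ (Fin d) × EuclideanSpace ℝ (Fin q) =>
      κ (h⁻¹ • (x - z.1)) := hκm.comp (by fun_prop)
    exact h1.mul ((hχm.comp measurable_snd).mul hf_meas)
  have hint : Integrable fun z : EuclideanSpace ℝ (Fin d) × EuclideanSpace ℝ (Fin q) =>
      κ (h⁻¹ • (x - z.1)) * (χ z.2 * f z.1 z.2) := by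
    rw [Measure.volume_eq_prod]
    rw [integrable_prod_iff hmeas.aestronglyMeasurable]
    refine ⟨ae_of_all _ fun t => (hχ.integrable t).const_mul (κ (h⁻¹ • (x - t))), ?_⟩
    refine (hκx.abs.mul_const C).mono' ?_ (ae_of_all _ fun t => ?_)
    · exact hmeas.norm.stronglyMeasurable.integral_prod_right'.aestronglyMeasurable
    · simp only [norm_mul]
      rw [integral_const_mul, norm_mul]
      simp only [Real.norm_eq_abs, abs_abs]
      gcongr
      simp only [abs_of_nonneg (hf_nonneg t _)]
      rw [abs_of_nonneg (integral_nonneg fun y => mul_nonneg (abs_nonneg _) (hf_nonneg t y))]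
      exact hC t
  constructor
  · have h1 : Integrable G (P.map fun ω => (X ω, Y ω)) := by
      rw [hlaw, integrable_withDensity_iff_integrable_smul' hdens
        (ae_of_all _ fun z => ENNReal.ofReal_lt_top)]
      simpa only [hsm] using hint
    exact (integrable_map_measure hG.aestronglyMeasurable hXY.aemeasurable).1 h1
  · calc ∫ ω, κ (h⁻¹ • (x - X ω)) * χ (Y ω) ∂P = ∫ z, G z ∂(P.map fun ω => (X ω, Y ω)) :=
          (integral_map hXY.aemeasurable hG.aestronglyMeasurable).symm
      _ = ∫ z : EuclideanSpace ℝ (Fin d) × EuclideanSpace ℝ (Fin q),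
            κ (h⁻¹ • (x - z.1)) * (χ z.2 * f z.1 z.2) := by
          rw [hlaw, integral_withDensity_eq_integral_toReal_smul hdens
            (ae_of_all _ fun z => ENNReal.ofReal_lt_top)]
          simp only [hsm]
      _ = ∫ t, κ (h⁻¹ • (x - t)) * ∫ y, χ y * f t y := by
          rw [Measure.volume_eq_prod] at hint ⊢
          rw [integral_prod _ hint]
          simp only [integral_const_mul]
      _ = h ^ d * ∫ z, κ z * ∫ y, χ y * f (x - h • z) y := by
          have h1 := Measure.integral_comp_smul (volume : Measure (EuclideanSpace ℝ (Fin d)))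
            (fun w => κ (h⁻¹ • w) * ∫ y, χ y * f (x - w) y) h
          have h2 := integral_sub_left_eq_self
            (fun w => κ (h⁻¹ • w) * ∫ y, χ y * f (x - w) y)
            (volume : Measure (EuclideanSpace ℝ (Fin d))) x
          simp only [sub_sub_cancel] at h2
          simp only [smul_smul, inv_mul_cancel₀ hh.ne', one_smul, finrank_euclideanSpace,
            Fintype.card_fin] at h1
          rw [h1, h2, smul_eq_mul, abs_of_pos (by positivity), ← mul_assoc,
            mul_inv_cancel₀ (by positivity), one_mul]

/-- Second order expansion of the moment generating function of a kernel weight. -/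
lemma exists_mgf_kernel_expansion [IsProbabilityMeasure P]
    (hf_meas : Measurable (Function.uncurry f)) (hf_nonneg : ∀ t y, 0 ≤ f t y)
    {K : EuclideanSpace ℝ (Fin d) → ℝ} (hK_meas : Measurable K) (hK_int : Integrable K)
    {CK : ℝ} (hCK : ∀ z, |K z| ≤ CK)
    {ψ : EuclideanSpace ℝ (Fin q) → ℝ} (hψm : Measurable ψ)
    (hψ : ∀ c, 0 ≤ c → IsBoundedlyIntegrable f fun y => Real.exp (c * |ψ y|))
    (x : EuclideanSpace ℝ (Fin d)) :
    ∃ C : ℝ, ∀ (X : Ω → EuclideanSpace ℝ (Fin d)) (Y : Ω → EuclideanSpace ℝ (Fin q)),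
      Measurable X → Measurable Y → P.map (fun ω => (X ω, Y ω)) =
        (volume : Measure (EuclideanSpace ℝ (Fin d) × EuclideanSpace ℝ (Fin q))).withDensity
          (fun z => ENNReal.ofReal (f z.1 z.2)) →
      ∀ θ h : ℝ, 0 ≤ θ → θ ≤ 1 → 0 < h →
      Integrable (fun ω => Real.exp (θ * (K (h⁻¹ • (x - X ω)) * ψ (Y ω)))) P ∧
      ∃ b : ℝ, ∫ ω, Real.exp (θ * (K (h⁻¹ • (x - X ω)) * ψ (Y ω))) ∂P = 1 + h ^ d * b ∧
        |b - θ * (∫ z, K z * ∫ y, ψ y * f (x - h • z) y)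
          - θ ^ 2 / 2 * ∫ z, K z ^ 2 * ∫ y, ψ y ^ 2 * f (x - h • z) y| ≤ C * θ ^ 3 := by
  have hCK0 : 0 ≤ CK := (abs_nonneg _).trans (hCK 0)
  -- Powers of `ψ` are absorbed by one more unit of exponential moment; `6 = 3!` bounds the
  -- factorials involved.
  have hpow : ∀ k : ℕ, k ≤ 3 → ∀ c : ℝ, 0 ≤ c → ∀ y, |ψ y| ^ k * Real.exp (c * |ψ y|) ≤
      6 * Real.exp ((c + 1) * |ψ y|) := by
    intro k hk c hc y
    have h1 := Real.pow_div_factorial_le_exp |ψ y| (abs_nonneg _) k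
    rw [div_le_iff₀ (by positivity)] at h1
    have h2 : (k.factorial : ℝ) ≤ 6 := by
      exact_mod_cast (Nat.factorial_le hk)
    calc _ ≤ (Real.exp |ψ y| * 6) * Real.exp (c * |ψ y|) := by
          gcongr
          exact h1.trans (by gcongr)
      _ = _ := by rw [add_mul, one_mul, Real.exp_add]; ring
  have hχ1 : IsBoundedlyIntegrable f ψ :=
    (hψ 1 zero_le_one).mono hf_meas hf_nonneg hψm (A := 6) (by norm_num) fun y => by
      rw [abs_of_pos (Real.exp_pos _)]
      simpa using hpow 1 (by norm_num) 0 le_rfl y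
  have hχ2 : IsBoundedlyIntegrable f (fun y => ψ y ^ 2) :=
    (hψ 1 zero_le_one).mono hf_meas hf_nonneg (by fun_prop) (A := 6) (by norm_num) fun y => by
      rw [abs_of_pos (Real.exp_pos _)]
      simpa using hpow 2 (by norm_num) 0 le_rfl y
  have hχ3 : IsBoundedlyIntegrable f (fun y => |ψ y| ^ 3 * Real.exp (CK * |ψ y|)) :=
    (hψ (CK + 1) (by positivity)).mono hf_meas hf_nonneg (by fun_prop) (A := 6) (by norm_num)
      fun y => by
        rw [abs_of_pos (Real.exp_pos _), abs_of_nonneg (by positivity)]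
        exact hpow 3 le_rfl CK hCK0 y
  obtain ⟨C₃, hC₃⟩ := hχ3.abs_integral_le hf_nonneg
  have hK2 : Integrable fun z => K z ^ 2 := by
    refine (hK_int.mul_bdd (c := CK) hK_int.aestronglyMeasurable
      (ae_of_all _ fun z => hCK z)).congr (ae_of_all _ fun z => ?_)
    simp only [sq]
  have hK3 : Integrable fun z => |K z| ^ 3 := by
    refine (hK2.mul_bdd (c := CK) hK_int.abs.aestronglyMeasurable
      (ae_of_all _ fun z => by simpa using hCK z)).congr (ae_of_all _ fun z => ?_)
    simp only [← sq_abs (K z)]; ring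
  refine ⟨C₃ * ∫ z, |K z| ^ 3, fun X Y hX hY hlaw θ h hθ0 hθ1 hh => ?_⟩
  obtain ⟨hi1, he1⟩ := integral_kernel_mul_weight hX hY hf_meas hf_nonneg hlaw hK_meas hK_int hχ1
    x hh
  obtain ⟨hi2, he2⟩ := integral_kernel_mul_weight hX hY hf_meas hf_nonneg hlaw
    (hK_meas.pow_const 2) hK2 hχ2 x hh
  obtain ⟨hi3, he3⟩ := integral_kernel_mul_weight hX hY hf_meas hf_nonneg hlaw
    (κ := fun z => |K z| ^ 3) (by fun_prop) hK3 hχ3 x hh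
  set ξ : Ω → ℝ := fun ω => K (h⁻¹ • (x - X ω)) * ψ (Y ω) with hξ
  have hξm : Measurable ξ := by
    have h1 : Measurable fun ω => K (h⁻¹ • (x - X ω)) := hK_meas.comp (by fun_prop)
    exact h1.mul (hψm.comp hY)
  have hR : ∀ ω, |Real.exp (θ * ξ ω) - (1 + θ * ξ ω + (θ * ξ ω) ^ 2 / 2)| ≤
      θ ^ 3 * (|K (h⁻¹ • (x - X ω))| ^ 3 * (|ψ (Y ω)| ^ 3 * Real.exp (CK * |ψ (Y ω)|))) := by
    intro ω
    refine (Real.abs_exp_sub_taylor_two_le _).trans ?_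
    have h1 : |θ * ξ ω| = θ * (|K (h⁻¹ • (x - X ω))| * |ψ (Y ω)|) := by
      rw [abs_mul, abs_of_nonneg hθ0, abs_mul]
    -- Here `θ ≤ 1` makes the exponential in the remainder independent of `θ`, leaving `θ ^ 3` times
    -- a fixed integrable weight.
    have h2 : |θ * ξ ω| ≤ CK * |ψ (Y ω)| := by
      rw [h1]
      calc _ ≤ 1 * (|K (h⁻¹ • (x - X ω))| * |ψ (Y ω)|) := by gcongr
        _ ≤ _ := by rw [one_mul]; gcongr; exact hCK _
    calc _ ≤ |θ * ξ ω| ^ 3 * Real.exp (CK * |ψ (Y ω)|) := by gcongr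
      _ = _ := by rw [h1]; ring
  have hRi : Integrable (fun ω => Real.exp (θ * ξ ω) - (1 + θ * ξ ω + (θ * ξ ω) ^ 2 / 2)) P :=
    (hi3.const_mul (θ ^ 3)).mono' (by fun_prop) (ae_of_all _ hR)
  have hi2' : Integrable (fun ω => (θ * ξ ω) ^ 2 / 2) P := by
    refine (hi2.const_mul (θ ^ 2 / 2)).congr (ae_of_all _ fun ω => ?_)
    simp only [hξ]; ring
  have hT : Integrable (fun ω => 1 + θ * ξ ω + (θ * ξ ω) ^ 2 / 2) P :=
    ((integrable_const 1).add (hi1.const_mul θ)).add hi2'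
  have hTv : ∫ ω, (1 + θ * ξ ω + (θ * ξ ω) ^ 2 / 2) ∂P = 1 +
      h ^ d * (θ * ∫ z, K z * ∫ y, ψ y * f (x - h • z) y) +
      h ^ d * (θ ^ 2 / 2 * ∫ z, K z ^ 2 * ∫ y, ψ y ^ 2 * f (x - h • z) y) := by
    have e2 : ∫ ω, (θ * ξ ω) ^ 2 / 2 ∂P =
        h ^ d * (θ ^ 2 / 2 * ∫ z, K z ^ 2 * ∫ y, ψ y ^ 2 * f (x - h • z) y) := by
      rw [mul_left_comm, ← he2, ← integral_const_mul]
      congr 1; funext ω; simp only [hξ]; ring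
    have hlin : Integrable (fun ω => 1 + θ * ξ ω) P := (integrable_const 1).add (hi1.const_mul θ)
    rw [integral_add hlin hi2', integral_add (integrable_const 1) (hi1.const_mul θ), e2, integral_const_mul, he1]
    simp only [integral_const, probReal_univ, smul_eq_mul]
    ring
  have hexp : Integrable (fun ω => Real.exp (θ * ξ ω)) P :=
    (hRi.add hT).congr (ae_of_all _ fun ω => by simp)
  -- The factor `h ^ d` comes out because the linear, quadratic and remainder terms all carry the
  -- Jacobian of `t = x - h • z`.
  refine ⟨hexp, (∫ ω, Real.exp (θ * ξ ω) ∂P - 1) / h ^ d, ?_, ?_⟩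
  · rw [mul_div_cancel₀ _ (by positivity)]; simp only [hξ]; ring
  · have hRv : |∫ ω, (Real.exp (θ * ξ ω) - (1 + θ * ξ ω + (θ * ξ ω) ^ 2 / 2)) ∂P| ≤
        h ^ d * (C₃ * (∫ z, |K z| ^ 3) * θ ^ 3) := by
      refine (norm_integral_le_of_norm_le (hi3.const_mul (θ ^ 3))
        (ae_of_all _ fun ω => (Real.norm_eq_abs _).trans_le (hR ω))).trans ?_
      rw [integral_const_mul, he3]
      have : ∫ z, |K z| ^ 3 * ∫ y, |ψ y| ^ 3 * Real.exp (CK * |ψ y|) * f (x - h • z) y ≤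
          ∫ z, |K z| ^ 3 * C₃ := by
        refine integral_mono (integrable_kernel_mul hK3
          (stronglyMeasurable_integral_mul hχ3.measurable hf_meas) hC₃ h)
          (hK3.mul_const _) fun z => ?_
        exact mul_le_mul_of_nonneg_left ((le_abs_self _).trans (hC₃ _)) (by positivity)
      rw [integral_mul_const] at this
      calc _ ≤ θ ^ 3 * (h ^ d * ((∫ z, |K z| ^ 3) * C₃)) := by gcongr
        _ = _ := by ring
    rw [integral_sub hexp hT, hTv] at hRv
    have hpos : 0 < h ^ d := by positivity
    refine le_of_mul_le_mul_left (le_trans (le_of_eq ?_) hRv) hpos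
    rw [← abs_of_pos hpos, ← abs_mul, abs_of_pos hpos]
    congr 1
    field_simp
    ring

end KernelExpectation

/-! ### Bias of smoothed affine moments. -/

section AffineMoments

variable {d q : ℕ} {f : EuclideanSpace ℝ (Fin d) → EuclideanSpace ℝ (Fin q) → ℝ}

lemma integral_affine_mul (hint0 : ∀ t, Integrable (f t))
    (hint1 : ∀ t, Integrable fun y => f t y • y) (a : ℝ) (u : EuclideanSpace ℝ (Fin q))
    (t : EuclideanSpace ℝ (Fin d)) :
    ∫ y, (a + inner ℝ u y) * f t y =
      a * marginalDensity f t + inner ℝ u (unnormalizedRegression f t) := by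
  have h1 : ∀ y, inner ℝ u y * f t y = inner ℝ u (f t y • y) := fun y => by
    rw [real_inner_smul_right, mul_comm]
  have h2 : Integrable fun y => inner ℝ u (f t y • y) := (hint1 t).const_inner u
  simp only [add_mul, h1]
  rw [integral_add ((hint0 t).const_mul a) h2, integral_const_mul, integral_inner (hint1 t)]
  rfl

/-- The bias of the kernel smoothing of affine moments is negligible at scale `1 / v n`. -/
lemma tendsto_bias_affine (hf_meas : Measurable (Function.uncurry f))
    (hf_nonneg : ∀ t y, 0 ≤ f t y)
    (haff : ∀ (a : ℝ) (u : EuclideanSpace ℝ (Fin q)),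
      IsBoundedlyIntegrable f fun y => a + inner ℝ u y)
    (hint1 : ∀ t, Integrable fun y => f t y • y)
    {K : EuclideanSpace ℝ (Fin d) → ℝ} (hK_meas : Measurable K) (hK_int : Integrable K)
    (hK_one : ∫ z, K z = 1) {p : ℕ} (hp : 1 ≤ p) (hK : HasKernelOrder K p)
    {x : EuclideanSpace ℝ (Fin d)}
    (hm : HasBoundedDifferential (unnormalizedRegression f) p x)
    (hg : HasBoundedDifferential (marginalDensity f) p x)
    {v h : ℕ → ℝ} (hvh : Tendsto (fun n => v n * h n ^ p) atTop (𝓝 0))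
    (a : ℝ) (u : EuclideanSpace ℝ (Fin q)) :
    Tendsto (fun n => v n * ((∫ z, K z * ∫ y, (a + inner ℝ u y) * f (x - h n • z) y) -
      ∫ y, (a + inner ℝ u y) * f x y)) atTop (𝓝 0) := by
  have hint0 : ∀ t, Integrable (f t) := fun t => by
    simpa using (haff 1 0).integrable t
  have hMeq := integral_affine_mul hint0 hint1
  have hcomp : ∀ u : EuclideanSpace ℝ (Fin q), ∃ C : ℝ, ∀ t,
      |inner ℝ u (unnormalizedRegression f t)| ≤ C := fun u => by
    obtain ⟨C, hC⟩ := (haff 0 u).abs_integral_le hf_nonneg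
    exact ⟨C, fun t => by have := hC t; rw [hMeq] at this; simpa using this⟩
  have hKg : ∀ s : ℝ, Integrable fun z => K z • marginalDensity f (x - s • z) := by
    intro s
    obtain ⟨C, hC⟩ := (haff 1 0).abs_integral_le hf_nonneg
    have hsm := stronglyMeasurable_integral_mul (haff 1 0).measurable hf_meas
    have := integrable_kernel_mul (x := x) hK_int hsm hC s
    simp only [hMeq] at this
    simpa using this
  have hmm : StronglyMeasurable (unnormalizedRegression f) := by
    refine StronglyMeasurable.integral_prod_right (f := fun t y => f t y • y) ?_
    exact (hf_meas.smul measurable_snd).stronglyMeasurable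
  have hKm : ∀ s : ℝ, Integrable fun z => K z • unnormalizedRegression f (x - s • z) := by
    intro s
    choose C hC using hcomp
    have hnorm : ∀ t, ‖unnormalizedRegression f t‖ ≤
        ∑ i, C (EuclideanSpace.basisFun (Fin q) ℝ i) := fun t => by
      conv_lhs => rw [← (EuclideanSpace.basisFun (Fin q) ℝ).sum_repr' (unnormalizedRegression f t)]
      refine (norm_sum_le _ _).trans (Finset.sum_le_sum fun i _ => ?_)
      rw [norm_smul, (EuclideanSpace.basisFun (Fin q) ℝ).norm_eq_one, mul_one]
      exact hC _ t
    have hmx : StronglyMeasurable fun z => unnormalizedRegression f (x - s • z) :=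
      hmm.comp_measurable (by fun_prop)
    exact hK_int.smul_bdd _ hmx.aestronglyMeasurable (ae_of_all _ fun z => hnorm _)
  obtain ⟨C₁, hC₁⟩ := hK.norm_bias_le hK_meas hK_int hK_one hp hg
  obtain ⟨C₂, hC₂⟩ := hK.norm_bias_le hK_meas hK_int hK_one hp hm
  refine squeeze_zero_norm (a := fun n => |v n * h n ^ p| * (|a| * C₁ + ‖u‖ * C₂)) (fun n => ?_) ?_
  -- An affine moment is `a * g + ⟪u, m⟫`, so its bias is the same combination of the biases of `g`
  -- and `m`.
  · have heq : (∫ z, K z * ∫ y, (a + inner ℝ u y) * f (x - h n • z) y) -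
        ∫ y, (a + inner ℝ u y) * f x y =
        a * ((∫ z, K z • marginalDensity f (x - h n • z)) - marginalDensity f x) +
        inner ℝ u ((∫ z, K z • unnormalizedRegression f (x - h n • z)) -
          unnormalizedRegression f x) := by
      have e1 : ∀ z, K z * (a * marginalDensity f (x - h n • z) +
          inner ℝ u (unnormalizedRegression f (x - h n • z))) =
          a * (K z • marginalDensity f (x - h n • z)) +
          inner ℝ u (K z • unnormalizedRegression f (x - h n • z)) := fun z => by
        rw [real_inner_smul_right, smul_eq_mul]; ring
      simp only [hMeq, e1]
      rw [integral_add ((hKg _).const_mul a) ((hKm _).const_inner u), integral_const_mul,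
        integral_inner (hKm _), inner_sub_right]
      ring
    rw [heq, norm_mul, Real.norm_eq_abs, abs_mul (v n), abs_pow, mul_assoc]
    refine mul_le_mul_of_nonneg_left ?_ (abs_nonneg _)
    calc _ ≤ |a| * ‖(∫ z, K z • marginalDensity f (x - h n • z)) - marginalDensity f x‖ +
          ‖u‖ * ‖(∫ z, K z • unnormalizedRegression f (x - h n • z)) -
            unnormalizedRegression f x‖ := by
          refine (norm_add_le _ _).trans (add_le_add ?_ (norm_inner_le_norm _ _))
          rw [norm_mul, Real.norm_eq_abs a]
      _ ≤ |a| * (C₁ * |h n| ^ p) + ‖u‖ * (C₂ * |h n| ^ p) := by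
          gcongr
          · exact hC₁ _ (hKg _)
          · exact hC₂ _ (hKm _)
      _ = _ := by ring
  · simpa using hvh.abs.mul_const (|a| * C₁ + ‖u‖ * C₂)

end AffineMoments

/-! ### Scaled logarithmic moment generating functions of i.i.d. kernel sums. -/

section IIDSums

variable {Ω α : Type*} [MeasurableSpace Ω] [MeasurableSpace α] {P : Measure Ω}
  [IsProbabilityMeasure P]

lemma integral_exp_sum_iid {S : ℕ → Ω → α} {μ : Measure α} (hS : ∀ i, Measurable (S i))
    (hlaw : ∀ i, P.map (S i) = μ) (hindep : iIndepFun S P) {Φ : α → ℝ} (hΦ : Measurable Φ) (θ : ℝ)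
    (hint : Integrable (fun ω => Real.exp (θ * Φ (S 0 ω))) P) (n : ℕ) :
    Integrable (fun ω => Real.exp (θ * ∑ i ∈ Finset.range n, Φ (S i ω))) P ∧
      ∫ ω, Real.exp (θ * ∑ i ∈ Finset.range n, Φ (S i ω)) ∂P =
        (∫ ω, Real.exp (θ * Φ (S 0 ω)) ∂P) ^ n := by
  have hm : ∀ i, Measurable (fun ω => Φ (S i ω)) := fun i => hΦ.comp (hS i)
  have hind : iIndepFun (fun i ω => Φ (S i ω)) P := hindep.comp (fun _ => Φ) (fun _ => hΦ)
  have hexp : Measurable fun a => Real.exp (θ * Φ a) := by fun_prop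
  have hi : ∀ i, Integrable (fun ω => Real.exp (θ * Φ (S i ω))) P := by
    have h0 : Integrable (fun a => Real.exp (θ * Φ a)) μ := by
      rw [← hlaw 0]
      exact (integrable_map_measure hexp.aestronglyMeasurable (hS 0).aemeasurable).2 hint
    intro i
    rw [← hlaw i] at h0
    exact (integrable_map_measure hexp.aestronglyMeasurable (hS i).aemeasurable).1 h0
  have he : ∀ i, ∫ ω, Real.exp (θ * Φ (S i ω)) ∂P = ∫ ω, Real.exp (θ * Φ (S 0 ω)) ∂P := by
    intro i
    rw [← integral_map (hS i).aemeasurable hexp.aestronglyMeasurable, hlaw i, ← hlaw 0,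
      integral_map (hS 0).aemeasurable hexp.aestronglyMeasurable]
  constructor
  · simpa using hind.integrable_exp_mul_sum hm (s := Finset.range n) (t := θ) (fun i _ => hi i)
  · have := hind.mgf_sum hm (Finset.range n) (t := θ)
    simpa [mgf, he] using this

end IIDSums

section ScaledMGF

variable {Ω : Type*} [MeasurableSpace Ω] {P : Measure Ω} [IsProbabilityMeasure P] {d q : ℕ}
  {X : ℕ → Ω → EuclideanSpace ℝ (Fin d)} {Y : ℕ → Ω → EuclideanSpace ℝ (Fin q)}
  {f : EuclideanSpace ℝ (Fin d) → EuclideanSpace ℝ (Fin q) → ℝ}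

/-- Limit of the scaled logarithmic moment generating functions of the centred kernel sums, in the
moderate deviations regime. -/
theorem eventually_mgf_kernelSum_bounds (hd : d ≠ 0)
    (hX : ∀ i, Measurable (X i)) (hY : ∀ i, Measurable (Y i))
    (hf_meas : Measurable (Function.uncurry f)) (hf_nonneg : ∀ t y, 0 ≤ f t y)
    (hlaw : ∀ i, P.map (fun ω => (X i ω, Y i ω)) =
      (volume : Measure (EuclideanSpace ℝ (Fin d) × EuclideanSpace ℝ (Fin q))).withDensity
        (fun z => ENNReal.ofReal (f z.1 z.2)))
    (hindep : iIndepFun (fun i ω => (X i ω, Y i ω)) P)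
    {K : EuclideanSpace ℝ (Fin d) → ℝ} (hK_meas : Measurable K) (hK_int : Integrable K)
    {CK : ℝ} (hCK : ∀ z, |K z| ≤ CK)
    {h v : ℕ → ℝ} (hh_pos : ∀ n, 1 ≤ n → 0 < h n) (hh_zero : Tendsto h atTop (𝓝 0))
    (hv : Tendsto v atTop atTop)
    {ψ : EuclideanSpace ℝ (Fin q) → ℝ} (hψm : Measurable ψ)
    (hψ : ∀ c, 0 ≤ c → IsBoundedlyIntegrable f fun y => Real.exp (c * |ψ y|))
    (hψ2 : IsBoundedlyIntegrable f fun y => ψ y ^ 2)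
    {x : EuclideanSpace ℝ (Fin d)}
    (hV : ContinuousAt (fun t => ∫ y, ψ y ^ 2 * f t y) x)
    (hbias : Tendsto (fun n => v n * ((∫ z, K z * ∫ y, ψ y * f (x - h n • z) y) -
      ∫ y, ψ y * f x y)) atTop (𝓝 0)) {ε : ℝ} (hε : 0 < ε) :
    ∀ᶠ n : ℕ in atTop,
      Integrable (fun ω => Real.exp ((n : ℝ) * h n ^ d / v n ^ 2 *
        (v n / (n * h n ^ d) * (∑ i ∈ Finset.range n, K ((h n)⁻¹ • (x - X i ω)) * ψ (Y i ω))
          - v n * ∫ y, ψ y * f x y))) P ∧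
      Real.exp ((n : ℝ) * h n ^ d / v n ^ 2 *
        ((∫ z, K z ^ 2) * (∫ y, ψ y ^ 2 * f x y) / 2 - ε)) ≤
        ∫ ω, Real.exp ((n : ℝ) * h n ^ d / v n ^ 2 *
        (v n / (n * h n ^ d) * (∑ i ∈ Finset.range n, K ((h n)⁻¹ • (x - X i ω)) * ψ (Y i ω))
          - v n * ∫ y, ψ y * f x y)) ∂P ∧
      ∫ ω, Real.exp ((n : ℝ) * h n ^ d / v n ^ 2 *
        (v n / (n * h n ^ d) * (∑ i ∈ Finset.range n, K ((h n)⁻¹ • (x - X i ω)) * ψ (Y i ω))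
          - v n * ∫ y, ψ y * f x y)) ∂P ≤
        Real.exp ((n : ℝ) * h n ^ d / v n ^ 2 *
        ((∫ z, K z ^ 2) * (∫ y, ψ y ^ 2 * f x y) / 2 + ε)) := by
  obtain ⟨C, hC⟩ := exists_mgf_kernel_expansion (P := P) hf_meas hf_nonneg hK_meas hK_int hCK
    hψm hψ x
  set M : ℝ := ∫ y, ψ y * f x y with hM
  set V : ℝ := ∫ y, ψ y ^ 2 * f x y with hVdef
  set A : ℕ → ℝ := fun n => ∫ z, K z * ∫ y, ψ y * f (x - h n • z) y with hA
  set B : ℕ → ℝ := fun n => ∫ z, K z ^ 2 * ∫ y, ψ y ^ 2 * f (x - h n • z) y with hB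
  let b : ℕ → ℝ := fun n =>
    (∫ ω, Real.exp ((v n)⁻¹ * (K ((h n)⁻¹ • (x - X 0 ω)) * ψ (Y 0 ω))) ∂P - 1) / h n ^ d
  have hK2 : Integrable fun z => K z ^ 2 := by
    refine (hK_int.mul_bdd (c := CK) hK_int.aestronglyMeasurable
      (ae_of_all _ fun z => hCK z)).congr (ae_of_all _ fun z => ?_)
    simp only [sq]
  obtain ⟨CV, hCV⟩ := hψ2.abs_integral_le hf_nonneg
  have hBlim : Tendsto B atTop (𝓝 ((∫ z, K z ^ 2) * V)) :=
    tendsto_integral_kernel_mul hK2 (stronglyMeasurable_integral_mul hψ2.measurable hf_meas)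
      hCV hV hh_zero
  have hvinv : Tendsto (fun n => (v n)⁻¹) atTop (𝓝 0) := tendsto_inv_atTop_zero.comp hv
  have hmain : ∀ᶠ n in atTop, |b n - (v n)⁻¹ * A n - (v n)⁻¹ ^ 2 / 2 * B n| ≤ C * (v n)⁻¹ ^ 3 := by
    filter_upwards [hv.eventually_ge_atTop 1, eventually_ge_atTop 1] with n hvn hn
    have hhn := hh_pos n hn
    obtain ⟨-, b', hb', hle⟩ := hC (X 0) (Y 0) (hX 0) (hY 0) (hlaw 0) (v n)⁻¹ (h n)
      (by positivity) (inv_le_one_of_one_le₀ hvn) hhn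
    have : b n = b' := by
      simp only [b]; rw [hb', add_sub_cancel_left, mul_div_cancel_left₀ _ (by positivity)]
    rw [this]; exact hle
  -- With `θ = 1 / v n`, the expansion reads `v² b = v A + B / 2 + O(1 / v)`. The difference `v (A -
  -- M)` vanishes by the bias hypothesis, and `B` tends to `(∫ K ^ 2) * V`.
  have hlim1 : Tendsto (fun n => v n ^ 2 * b n - v n * M) atTop
      (𝓝 ((∫ z, K z ^ 2) * V / 2)) := by
    have herr : Tendsto (fun n => v n ^ 2 * (b n - (v n)⁻¹ * A n - (v n)⁻¹ ^ 2 / 2 * B n)) atTop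
        (𝓝 0) := by
      refine squeeze_zero_norm' (a := fun n => C * (v n)⁻¹) ?_ (by simpa using hvinv.const_mul C)
      filter_upwards [hmain, hv.eventually_ge_atTop 1] with n hn hvn
      rw [norm_mul, Real.norm_of_nonneg (by positivity)]
      calc _ ≤ v n ^ 2 * (C * (v n)⁻¹ ^ 3) := by gcongr; exact hn
        _ = _ := by field_simp
    have hsum := (herr.add hbias).add (hBlim.div_const 2)
    rw [add_zero, zero_add] at hsum
    refine hsum.congr' ?_
    filter_upwards [hv.eventually_ge_atTop 1] with n hvn
    have : v n ≠ 0 := by positivity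
    simp only [hA, hB]
    field_simp
    ring
  have hlim2 : Tendsto (fun n => v n * b n) atTop (𝓝 M) := by
    have := (hlim1.mul hvinv).add_const M
    rw [mul_zero, zero_add] at this
    refine this.congr' ?_
    filter_upwards [hv.eventually_ge_atTop 1] with n hvn
    have : v n ≠ 0 := by positivity
    field_simp
    ring
  have hhd : Tendsto (fun n => h n ^ d) atTop (𝓝 0) := by
    simpa [hd] using hh_zero.pow d
  -- This is the second order error in `log (1 + h ^ d * b)`, multiplied by `n` and divided by the
  -- speed. It vanishes because `h n ^ d → 0`, which needs `d ≠ 0`, while `v n * b n` stays bounded.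
  have hlim3 : Tendsto (fun n => 2 * (h n ^ d * (v n * b n) ^ 2)) atTop (𝓝 0) := by
    simpa using (hhd.mul (hlim2.pow 2)).const_mul 2
  have hlim4 : Tendsto (fun n => h n ^ d * b n) atTop (𝓝 0) := by
    have := hhd.mul (hlim2.mul hvinv)
    rw [zero_mul] at this
    refine this.congr' ?_
    filter_upwards [hv.eventually_ge_atTop 1] with n hvn
    have : v n ≠ 0 := by positivity
    field_simp
  set L : ℝ := (∫ z, K z ^ 2) * V / 2 with hL
  filter_upwards [hv.eventually_ge_atTop 1, eventually_ge_atTop 1,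
    hlim1.eventually (Ioo_mem_nhds (show L - ε / 2 < L by linarith) (show L < L + ε / 2 by linarith)),
    hlim3.eventually (gt_mem_nhds (half_pos hε)),
    hlim4.eventually (Ioo_mem_nhds (show (-(1 / 2) : ℝ) < 0 by norm_num)
      (show (0 : ℝ) < 1 / 2 by norm_num))] with n hvn hn h1 h3 h4
  have hhn := hh_pos n hn
  have hn0 : (0 : ℝ) < n := by exact_mod_cast hn
  have hv0 : 0 < v n := by linarith
  have hint0 := (hC (X 0) (Y 0) (hX 0) (hY 0) (hlaw 0) (v n)⁻¹ (h n)
      (by positivity) (inv_le_one_of_one_le₀ hvn) hhn).1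
  have hΦ : Measurable fun z : EuclideanSpace ℝ (Fin d) × EuclideanSpace ℝ (Fin q) =>
      K ((h n)⁻¹ • (x - z.1)) * ψ z.2 := by
    have : Measurable fun z : EuclideanSpace ℝ (Fin d) × EuclideanSpace ℝ (Fin q) =>
      K ((h n)⁻¹ • (x - z.1)) := hK_meas.comp (by fun_prop)
    exact this.mul (hψm.comp measurable_snd)
  obtain ⟨hiS, heS⟩ := integral_exp_sum_iid (fun i => (hX i).prodMk (hY i)) hlaw hindep hΦ
    (v n)⁻¹ hint0 n
  set ν : ℝ := (n : ℝ) * h n ^ d / v n ^ 2 with hν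
  have hνpos : 0 < ν := by positivity
  have hmgf : ∫ ω, Real.exp ((v n)⁻¹ * (K ((h n)⁻¹ • (x - X 0 ω)) * ψ (Y 0 ω))) ∂P =
      1 + h n ^ d * b n := by
    simp only [b]; rw [mul_div_cancel₀ _ (by positivity)]; ring
  simp only [hmgf] at heS
  have hexp : ∀ ω, Real.exp (ν * (v n / (n * h n ^ d) *
      (∑ i ∈ Finset.range n, K ((h n)⁻¹ • (x - X i ω)) * ψ (Y i ω)) - v n * M)) =
      Real.exp (-(ν * (v n * M))) *
        Real.exp ((v n)⁻¹ * ∑ i ∈ Finset.range n, K ((h n)⁻¹ • (x - X i ω)) * ψ (Y i ω)) := by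
    intro ω
    rw [← Real.exp_add]
    congr 1
    -- At this speed the tilt of the raw sum is exactly the `θ = 1 / v n` of the expansion.
    have : ν * (v n / (n * h n ^ d)) = (v n)⁻¹ := by rw [hν]; field_simp
    rw [mul_sub, ← mul_assoc, this]; ring
  simp only [hexp]
  rw [integral_const_mul, heS]
  have hpos : 0 < 1 + h n ^ d * b n := by linarith [h4.1]
  refine ⟨hiS.const_mul _, ?_, ?_⟩
  · have hlow := pow_le_pow_left₀ (Real.exp_pos _).le (Real.exp_sub_two_mul_sq_le h4.1.le) n
    rw [← Real.exp_nat_mul] at hlow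
    calc _ ≤ Real.exp (-(ν * (v n * M))) *
          Real.exp (n * (h n ^ d * b n - 2 * (h n ^ d * b n) ^ 2)) := by
          rw [← Real.exp_add]
          refine Real.exp_le_exp.2 ?_
          have : (n : ℝ) * (h n ^ d * b n - 2 * (h n ^ d * b n) ^ 2) =
              ν * (v n ^ 2 * b n - 2 * (h n ^ d * (v n * b n) ^ 2)) := by
            rw [hν]; field_simp
          rw [this, ← mul_neg, ← mul_add]
          refine mul_le_mul_of_nonneg_left ?_ hνpos.le
          linarith [h1.1]
      _ ≤ _ := by gcongr
  · have hup := pow_le_pow_left₀ hpos.le ((add_comm _ _).trans_le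
      (Real.add_one_le_exp (h n ^ d * b n))) n
    rw [← Real.exp_nat_mul] at hup
    calc _ ≤ Real.exp (-(ν * (v n * M))) * Real.exp (n * (h n ^ d * b n)) := by gcongr
      _ ≤ _ := by
          rw [← Real.exp_add]
          refine Real.exp_le_exp.2 ?_
          have : (n : ℝ) * (h n ^ d * b n) = ν * (v n ^ 2 * b n) := by
            rw [hν]; field_simp
          rw [this, ← mul_neg, ← mul_add]
          refine mul_le_mul_of_nonneg_left ?_ hνpos.le
          linarith [h1.2]

end ScaledMGF

/-! ### Positive definite quadratic forms and their duals. -/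

section QuadraticForms

variable {q : ℕ} {S : Matrix (Fin q) (Fin q) ℝ}

lemma EuclideanSpace.inner_eq_dotProduct (u w : EuclideanSpace ℝ (Fin q)) :
    inner ℝ u w = u.ofLp ⬝ᵥ w.ofLp := by
  rw [EuclideanSpace.inner_eq_star_dotProduct, star_trivial, dotProduct_comm]

lemma Matrix.PosDef.dotProduct_mulVec_comm (hS : S.PosDef) (a b : Fin q → ℝ) :
    a ⬝ᵥ (S *ᵥ b) = b ⬝ᵥ (S *ᵥ a) := by
  have hsymm : Sᵀ = S := by simpa [Matrix.IsSymm] using hS.1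
  rw [Matrix.dotProduct_mulVec, ← Matrix.mulVec_transpose, hsymm, dotProduct_comm]

lemma Matrix.PosDef.dotProduct_mulVec_add_smul (hS : S.PosDef) (a b : Fin q → ℝ) (s : ℝ) :
    (a + s • b) ⬝ᵥ (S *ᵥ (a + s • b)) =
      a ⬝ᵥ (S *ᵥ a) + 2 * s * (b ⬝ᵥ (S *ᵥ a)) + s ^ 2 * (b ⬝ᵥ (S *ᵥ b)) := by
  simp only [Matrix.mulVec_add, Matrix.mulVec_smul, dotProduct_add, add_dotProduct, dotProduct_smul,
    smul_dotProduct, smul_eq_mul, hS.dotProduct_mulVec_comm a b]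
  ring

lemma Matrix.PosDef.mulVec_inv_mulVec (hS : S.PosDef) (w : Fin q → ℝ) :
    S *ᵥ (S⁻¹ *ᵥ w) = w := by
  rw [Matrix.mulVec_mulVec, Matrix.mul_nonsing_inv _ ((Matrix.isUnit_iff_isUnit_det _).1 hS.isUnit),
    Matrix.one_mulVec]

lemma Matrix.PosDef.dotProduct_mulVec_self_nonneg (hS : S.PosDef) (a : Fin q → ℝ) :
    0 ≤ a ⬝ᵥ (S *ᵥ a) := by
  simpa using hS.posSemidef.dotProduct_mulVec_nonneg a

/-- Fenchel–Young inequality for a positive definite quadratic form and its dual. -/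
lemma Matrix.PosDef.dotProduct_le (hS : S.PosDef) {c : ℝ} (hc : 0 < c) (u w : Fin q → ℝ) :
    u ⬝ᵥ w ≤ (2 * c)⁻¹ * (w ⬝ᵥ (S⁻¹ *ᵥ w)) + c / 2 * (u ⬝ᵥ (S *ᵥ u)) := by
  set z := S⁻¹ *ᵥ w with hz
  have hw : S *ᵥ z = w := hS.mulVec_inv_mulVec w
  -- Completing the square: the Fenchel–Young defect is `(2c)⁻¹` times the form at `S⁻¹ w - c u`.
  have h1 := hS.dotProduct_mulVec_self_nonneg (z + (-c) • u)
  rw [hS.dotProduct_mulVec_add_smul, hw, dotProduct_comm z w] at h1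
  have h2 : (2 * c)⁻¹ * (w ⬝ᵥ z) + c / 2 * (u ⬝ᵥ (S *ᵥ u)) - u ⬝ᵥ w =
      (2 * c)⁻¹ * (w ⬝ᵥ z + 2 * -c * (u ⬝ᵥ w) + (-c) ^ 2 * (u ⬝ᵥ (S *ᵥ u))) := by
    field_simp; ring
  have h3 := mul_nonneg (show 0 ≤ (2 * c)⁻¹ by positivity) h1
  linarith

end QuadraticForms

/-! ### The large deviations principle for a quadratic limit. -/

section GaussianRate

variable {q : ℕ} {S : Matrix (Fin q) (Fin q) ℝ} {c : ℝ}

/-- Level sets are bounded because Fenchel–Young against `±e_i` bounds each coordinate; no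
eigenvalue estimate is needed. -/
lemma isGoodRateFunction_quadratic (hS : S.PosDef) (hc : 0 < c) :
    IsGoodRateFunction fun w : EuclideanSpace ℝ (Fin q) =>
      ENNReal.ofReal ((2 * c)⁻¹ * (w.ofLp ⬝ᵥ (S⁻¹ *ᵥ w.ofLp))) := by
  have hcont : Continuous fun w : EuclideanSpace ℝ (Fin q) =>
      ENNReal.ofReal ((2 * c)⁻¹ * (w.ofLp ⬝ᵥ (S⁻¹ *ᵥ w.ofLp))) := by
    refine ENNReal.continuous_ofReal.comp (continuous_const.mul ?_)
    have h1 : Continuous fun w : EuclideanSpace ℝ (Fin q) => w.ofLp := PiLp.continuous_ofLp 2 _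
    exact h1.dotProduct (continuous_const.matrix_mulVec h1)
  refine ⟨hcont.lowerSemicontinuous, fun α => ?_⟩
  refine Metric.isCompact_of_isClosed_isBounded (isClosed_le hcont continuous_const) ?_
  let β : (Fin q → ℝ) → ℝ := fun u => α + c / 2 * (u ⬝ᵥ (S *ᵥ u))
  have hK : IsCompact (WithLp.toLp 2 '' (Set.Icc (fun i => -β (Pi.single i (-1)))
      (fun i => β (Pi.single i 1)) : Set (Fin q → ℝ))) :=
    isCompact_Icc.image (PiLp.continuous_toLp 2 _)
  refine hK.isBounded.subset fun w hw => ?_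
  have hw' : (2 * c)⁻¹ * (w.ofLp ⬝ᵥ (S⁻¹ *ᵥ w.ofLp)) ≤ α := by
    have h1 : ENNReal.ofReal ((2 * c)⁻¹ * (w.ofLp ⬝ᵥ (S⁻¹ *ᵥ w.ofLp))) ≤ (α : ℝ≥0∞) := hw
    rwa [ENNReal.ofReal_le_iff_le_toReal ENNReal.coe_ne_top, ENNReal.coe_toReal] at h1
  have hle : ∀ u : Fin q → ℝ, u ⬝ᵥ w.ofLp ≤ β u := fun u =>
    (hS.dotProduct_le hc u w.ofLp).trans (by simp only [β]; linarith)
  refine ⟨w.ofLp, ⟨fun i => ?_, fun i => ?_⟩, rfl⟩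
  · have := hle (Pi.single i (-1))
    simp only [single_dotProduct] at this
    linarith
  · simpa using hle (Pi.single i 1)

variable {Ω : Type*} [MeasurableSpace Ω] {P : Measure Ω} [IsProbabilityMeasure P]
  {W Z : ℕ → Ω → EuclideanSpace ℝ (Fin q)} {ν : ℕ → ℝ}

/-- Gärtner–Ellis theorem for a positive definite quadratic limit, with a superexponentially good
random rescaling. -/
theorem satisfiesLDP_quadratic (hS : S.PosDef) (hc : 0 < c) (hν : IsSpeed ν)
    (hW : ∀ n, Measurable (W n))
    (hL : HasScaledLogMGF P W ν fun u => c / 2 * (u.ofLp ⬝ᵥ (S *ᵥ u.ofLp)))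
    (hZ : IsSuperexponentialRescaling P W Z ν) :
    SatisfiesLDP P Z ν fun w => ENNReal.ofReal ((2 * c)⁻¹ * (w.ofLp ⬝ᵥ (S⁻¹ *ᵥ w.ofLp))) := by
  set L : EuclideanSpace ℝ (Fin q) → ℝ := fun u => c / 2 * (u.ofLp ⬝ᵥ (S *ᵥ u.ofLp)) with hLdef
  set R : EuclideanSpace ℝ (Fin q) → ℝ := fun w => (2 * c)⁻¹ * (w.ofLp ⬝ᵥ (S⁻¹ *ᵥ w.ofLp)) with hR
  have hL0 : ∀ u, 0 ≤ L u := fun u =>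
    mul_nonneg (by positivity) (hS.dotProduct_mulVec_self_nonneg _)
  have hR0 : ∀ w, 0 ≤ R w := fun w =>
    mul_nonneg (by positivity) (hS.inv.dotProduct_mulVec_self_nonneg _)
  -- `grad w` is the tilt at which `L` has gradient `w`, hence the maximiser of `⟪u, w⟫ - L u`, with
  -- value `R w`. It exists for every `w`, so the lower bound holds at every point.
  let grad : EuclideanSpace ℝ (Fin q) → EuclideanSpace ℝ (Fin q) :=
    fun w => WithLp.toLp 2 (c⁻¹ • (S⁻¹ *ᵥ w.ofLp))
  have hgradS : ∀ w, S *ᵥ (grad w).ofLp = c⁻¹ • w.ofLp := fun w => by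
    simp only [grad]
    rw [Matrix.mulVec_smul, hS.mulVec_inv_mulVec]
  have hgradR : ∀ w, inner ℝ (grad w) w - L (grad w) = R w := fun w => by
    rw [EuclideanSpace.inner_eq_dotProduct]
    simp only [hLdef, hR, hgradS]
    simp only [grad, smul_dotProduct, dotProduct_smul, smul_eq_mul]
    rw [dotProduct_comm (S⁻¹ *ᵥ w.ofLp)]
    field_simp
    ring
  have hcoe : ∀ w, ((ENNReal.ofReal (R w) : ℝ≥0∞) : EReal) = (R w : EReal) := fun w => by
    rw [EReal.coe_ennreal_ofReal, max_eq_left (hR0 w)]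
  refine ⟨hν, fun U hU => ?_, fun V hV => ?_⟩
  · rw [EReal.neg_le]
    by_contra! hcon
    set b := liminf (fun n => (((ν n)⁻¹ : ℝ) : EReal) * ENNReal.log (P {ω | Z n ω ∈ U})) atTop
    have hb0 : 0 ≤ -b := (EReal.coe_ennreal_nonneg _).trans hcon.le
    rw [← EReal.coe_toENNReal hb0, EReal.coe_ennreal_lt_coe_ennreal_iff] at hcon
    simp only [iInf_lt_iff] at hcon
    obtain ⟨w, hwU, hw⟩ := hcon
    rw [← EReal.coe_ennreal_lt_coe_ennreal_iff, EReal.coe_toENNReal hb0, hcoe] at hw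
    obtain ⟨r, hr1, hr2⟩ := EReal.lt_iff_exists_real_btwn.1 hw
    rw [EReal.coe_lt_coe_iff] at hr1
    have hgrad : ∀ e, ∀ ρ > 0, ∃ s > 0,
        L (grad w + s • e) - L (grad w) - s * inner ℝ e w < s * ρ := by
      intro e ρ hρ
      -- The left side is exactly `s * (s * L e)`, so `s * L e < ρ` suffices; the `+ 1` covers `L e
      -- = 0`.
      refine ⟨ρ / (L e + 1), by have := hL0 e; positivity, ?_⟩
      set s := ρ / (L e + 1) with hs
      have hspos : 0 < s := by have := hL0 e; positivity
      have hsL : s * L e < ρ := by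
        have h1 : s * (L e + 1) = ρ := div_mul_cancel₀ _ (by have := hL0 e; positivity)
        linarith
      have hexpand : L (grad w + s • e) - L (grad w) - s * inner ℝ e w = s * (s * L e) := by
        rw [EuclideanSpace.inner_eq_dotProduct]
        simp only [hLdef, WithLp.ofLp_add, WithLp.ofLp_smul]
        rw [hS.dotProduct_mulVec_add_smul, hgradS]
        simp only [dotProduct_smul, smul_eq_mul]
        field_simp
        ring
      rw [hexpand]
      gcongr
    have hlow := le_liminf_scaled_log (P := P) hν.2 (eventually_le_measureReal_open hν.2 hL hW hZ
      hgrad hU hwU (ε := (r - R w) / 3) (by linarith))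
    rw [hgradR] at hlow
    have hr : R w + 3 * ((r - R w) / 3) = r := by ring
    rw [hr, EReal.coe_neg, EReal.neg_le] at hlow
    exact absurd hr2 (not_lt.2 hlow)
  · rw [EReal.le_neg]
    by_contra! hcon
    set b := limsup (fun n => (((ν n)⁻¹ : ℝ) : EReal) * ENNReal.log (P {ω | Z n ω ∈ V})) atTop
    -- Probabilities are at most `1`. This makes the levels `r₁ < r₂` chosen below positive, as the
    -- half-space bound needs; two levels are taken because the closed-set bound loses a little of
    -- the rate.
    have hb0 : 0 ≤ -b := by
      have := limsup_scaled_log_le (P := P) (S := fun n => {ω | Z n ω ∈ V}) hν.2 (c := 0)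
        (Eventually.of_forall fun n => by simp)
      rw [EReal.le_neg]
      simpa using this
    obtain ⟨r₁, h1, h1'⟩ := EReal.lt_iff_exists_real_btwn.1 hcon
    obtain ⟨r₂, h2, h2'⟩ := EReal.lt_iff_exists_real_btwn.1 h1'
    have hr1 : 0 < r₁ := by exact_mod_cast hb0.trans_lt h1
    have hr12 : r₁ < r₂ := by exact_mod_cast h2
    have hup := limsup_scaled_log_le (P := P) hν.2 (eventually_measureReal_closed_le hν.2 hL hL0 hZ
      hV (l := r₂) (l' := r₁) (by linarith) hr12 fun w hw => ⟨grad w, ?_⟩)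
    · rw [EReal.coe_neg, EReal.le_neg] at hup
      exact absurd h1 (not_lt.2 hup)
    · have hle : ((⨅ s ∈ V, ENNReal.ofReal (R s) : ℝ≥0∞) : EReal) ≤ (R w : EReal) := by
        rw [← hcoe, EReal.coe_ennreal_le_coe_ennreal_iff]
        exact iInf₂_le w hw
      have : r₂ < R w := by exact_mod_cast h2'.trans_le hle
      linarith [hgradR w]

end GaussianRate

/-! ### The conditional covariance matrix and its nondegeneracy. -/

section ConditionalCovariance

variable {d q : ℕ} {f : EuclideanSpace ℝ (Fin d) → EuclideanSpace ℝ (Fin q) → ℝ}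

lemma isBoundedlyIntegrable_affine_pow
    (hf_meas : Measurable (Function.uncurry f)) (hf_nonneg : ∀ t y, 0 ≤ f t y)
    (hexp : ∀ (a c : ℝ), 0 ≤ c → ∀ u : EuclideanSpace ℝ (Fin q),
      IsBoundedlyIntegrable f fun y => Real.exp (c * |a + inner ℝ u y|))
    (k : ℕ) (a : ℝ) (u : EuclideanSpace ℝ (Fin q)) :
    IsBoundedlyIntegrable f fun y => (a + inner ℝ u y) ^ k := by
  refine (hexp a 1 zero_le_one u).mono hf_meas hf_nonneg (by fun_prop)
    (A := k.factorial) (by positivity) fun y => ?_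
  have h1 := Real.pow_div_factorial_le_exp |a + inner ℝ u y| (abs_nonneg _) k
  rw [div_le_iff₀ (by positivity)] at h1
  rwa [abs_pow, abs_of_pos (Real.exp_pos _), one_mul, mul_comm]

lemma integrable_smul_id (hf_meas : Measurable (Function.uncurry f))
    (hpow : ∀ (k : ℕ) (a : ℝ) (u : EuclideanSpace ℝ (Fin q)),
      IsBoundedlyIntegrable f fun y => (a + inner ℝ u y) ^ k) (t : EuclideanSpace ℝ (Fin d)) :
    Integrable fun y => f t y • y := by
  have hft : Measurable (f t) := hf_meas.of_uncurry_left
  have hsum : Integrable fun y => ∑ i, |(0 + inner ℝ (EuclideanSpace.basisFun (Fin q) ℝ i) y) ^ 1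
      * f t y| :=
    integrable_finsetSum _ fun i _ => ((hpow 1 0 _).integrable t).abs
  refine hsum.mono' (by fun_prop) (ae_of_all _ fun y => ?_)
  have hy : f t y • y = ∑ i, f t y • (inner ℝ (EuclideanSpace.basisFun (Fin q) ℝ i) y •
      EuclideanSpace.basisFun (Fin q) ℝ i) := by
    rw [← Finset.smul_sum, (EuclideanSpace.basisFun (Fin q) ℝ).sum_repr' y]
  rw [hy]
  refine (norm_sum_le _ _).trans (Finset.sum_le_sum fun i _ => ?_)
  rw [norm_smul, norm_smul, (EuclideanSpace.basisFun (Fin q) ℝ).norm_eq_one, mul_one, abs_mul,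
    zero_add, pow_one, mul_comm, Real.norm_eq_abs, Real.norm_eq_abs]

lemma dotProduct_condCovariance_mulVec (hf_meas : Measurable (Function.uncurry f))
    (hf_nonneg : ∀ t y, 0 ≤ f t y)
    (hpow : ∀ (k : ℕ) (a : ℝ) (u : EuclideanSpace ℝ (Fin q)),
      IsBoundedlyIntegrable f fun y => (a + inner ℝ u y) ^ k)
    (t : EuclideanSpace ℝ (Fin d)) (u : EuclideanSpace ℝ (Fin q)) :
    u.ofLp ⬝ᵥ (condCovariance f t *ᵥ u.ofLp) =
      (∫ y, (-inner ℝ u (regression f t) + inner ℝ u y) ^ 2 * f t y) / marginalDensity f t := by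
  set r := regression f t with hr
  have hft : Measurable (f t) := hf_meas.of_uncurry_left
  have hsq : ∀ i, Integrable fun y : EuclideanSpace ℝ (Fin q) => (y i - r i) ^ 2 * f t y := by
    intro i
    have := (hpow 2 (-r i) (EuclideanSpace.single i 1)).integrable t
    simpa [EuclideanSpace.inner_single_left, neg_add_eq_sub] using this
  have hij : ∀ i j, Integrable fun y : EuclideanSpace ℝ (Fin q) =>
      (y i - r i) * (y j - r j) * f t y := by
    intro i j
    refine ((hsq i).add (hsq j)).mono' (by fun_prop) (ae_of_all _ fun y => ?_)
    rw [norm_mul, Real.norm_of_nonneg (hf_nonneg t y), Pi.add_apply, ← add_mul]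
    refine mul_le_mul_of_nonneg_right ?_ (hf_nonneg t y)
    rw [Real.norm_eq_abs, abs_le]
    constructor <;> nlinarith [sq_nonneg (y i - r i + (y j - r j)),
      sq_nonneg (y i - r i - (y j - r j)), sq_nonneg (y i - r i), sq_nonneg (y j - r j)]
  have hexpand : ∀ y : EuclideanSpace ℝ (Fin q),
      (-inner ℝ u r + inner ℝ u y) ^ 2 * f t y =
        ∑ i, ∑ j, u i * u j * ((y i - r i) * (y j - r j) * f t y) := by
    intro y
    rw [neg_add_eq_sub, ← inner_sub_right, EuclideanSpace.inner_eq_dotProduct, dotProduct, sq,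
      Finset.sum_mul_sum, Finset.sum_mul]
    refine Finset.sum_congr rfl fun i _ => ?_
    rw [Finset.sum_mul]
    refine Finset.sum_congr rfl fun j _ => ?_
    simp only [WithLp.ofLp_sub, Pi.sub_apply]
    ring
  simp only [hexpand]
  rw [integral_finsetSum _ fun i _ => integrable_finsetSum _ fun j _ => (hij i j).const_mul _]
  simp only [dotProduct, Matrix.mulVec, condCovariance, Matrix.of_apply, Finset.mul_sum,
    Finset.sum_div]
  refine Finset.sum_congr rfl fun i _ => ?_
  rw [integral_finsetSum _ fun j _ => (hij i j).const_mul _, Finset.sum_div]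
  refine Finset.sum_congr rfl fun j _ => ?_
  rw [integral_const_mul]
  ring

lemma measure_hyperplane_eq_zero {u : EuclideanSpace ℝ (Fin q)} (hu : u ≠ 0)
    (r : EuclideanSpace ℝ (Fin q)) :
    volume {y : EuclideanSpace ℝ (Fin q) | inner ℝ u y = inner ℝ u r} = 0 := by
  let A : AffineSubspace ℝ (EuclideanSpace ℝ (Fin q)) := AffineSubspace.mk' r (ℝ ∙ u)ᗮ
  have hA : {y : EuclideanSpace ℝ (Fin q) | inner ℝ u y = inner ℝ u r} = A := by
    ext y
    simp [A, AffineSubspace.mem_mk', Submodule.mem_orthogonal_singleton_iff_inner_right,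
      inner_sub_right, sub_eq_zero]
  rw [hA]
  refine Measure.addHaar_affineSubspace _ _ fun htop => ?_
  have h1 : r + u ∈ A := by rw [htop]; exact AffineSubspace.mem_top _ _ _
  simp only [A, AffineSubspace.mem_mk', vsub_eq_sub, add_sub_cancel_left,
    Submodule.mem_orthogonal_singleton_iff_inner_right, inner_self_eq_zero] at h1
  exact hu h1

/-- The conditional covariance matrix of a density is positive definite. -/
lemma condCovariance_posDef (hf_meas : Measurable (Function.uncurry f))
    (hf_nonneg : ∀ t y, 0 ≤ f t y)
    (hpow : ∀ (k : ℕ) (a : ℝ) (u : EuclideanSpace ℝ (Fin q)),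
      IsBoundedlyIntegrable f fun y => (a + inner ℝ u y) ^ k)
    {x : EuclideanSpace ℝ (Fin d)} (hg : marginalDensity f x ≠ 0) :
    (condCovariance f x).PosDef := by
  refine Matrix.PosDef.of_dotProduct_mulVec_pos ?_ fun u hu => ?_
  · ext i j
    simp only [condCovariance, Matrix.conjTranspose_apply, Matrix.of_apply, star_trivial,
      mul_comm (_ - regression f x i)]
  · have h1 := dotProduct_condCovariance_mulVec hf_meas hf_nonneg hpow x (WithLp.toLp 2 u)
    rw [star_trivial]
    simp only at h1
    rw [h1]
    have hgpos : 0 < marginalDensity f x :=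
      lt_of_le_of_ne (integral_nonneg (hf_nonneg x)) hg.symm
    refine div_pos ?_ hgpos
    have hnn : ∀ y : EuclideanSpace ℝ (Fin q), 0 ≤ (-inner ℝ (WithLp.toLp 2 u) (regression f x) +
      inner ℝ (WithLp.toLp 2 u) y) ^ 2 * f x y := fun y => mul_nonneg (sq_nonneg _) (hf_nonneg x y)
    -- Zero variance in direction `u` would make `f x` vanish almost everywhere off a hyperplane.
    -- Hyperplanes are null, so the marginal density at `x` would be zero.
    refine lt_of_le_of_ne (integral_nonneg hnn) fun h0 => hg ?_
    have hae := (integral_eq_zero_iff_of_nonneg hnn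
      ((hpow 2 _ (WithLp.toLp 2 u)).integrable x)).1 h0.symm
    have hnull := measure_hyperplane_eq_zero (u := WithLp.toLp 2 u) (by simpa using hu)
      (regression f x)
    refine integral_eq_zero_of_ae ?_
    filter_upwards [hae, measure_eq_zero_iff_ae_notMem.1 hnull] with y hy1 hy2
    rcases mul_eq_zero.1 hy1 with h | h
    · refine absurd ?_ hy2
      linarith [pow_eq_zero_iff (two_ne_zero) |>.1 h]
    · exact h

end ConditionalCovariance

/-! ### Linearisation of the Nadaraya–Watson estimator. -/

section Estimators

variable {Ω : Type*} {d q : ℕ} {K : EuclideanSpace ℝ (Fin d) → ℝ} {h : ℕ → ℝ}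
  {X : ℕ → Ω → EuclideanSpace ℝ (Fin d)} {Y : ℕ → Ω → EuclideanSpace ℝ (Fin q)}

lemma inner_numeratorEstimator_sub (n : ℕ) (x : EuclideanSpace ℝ (Fin d)) (ω : Ω)
    (u r : EuclideanSpace ℝ (Fin q)) :
    inner ℝ u (numeratorEstimator K h X Y n x ω - densityEstimator K h X n x ω • r) =
      ((n : ℝ) * h n ^ d)⁻¹ * ∑ i ∈ Finset.range n, K ((h n)⁻¹ • (x - X i ω)) *
        (-inner ℝ u r + inner ℝ u (Y i ω)) := by
  simp only [numeratorEstimator, densityEstimator, inner_sub_right, real_inner_smul_right,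
    inner_sum, mul_add, Finset.sum_add_distrib, ← Finset.sum_mul]
  ring

variable [MeasurableSpace Ω]

lemma measurable_densityEstimator (hK : Measurable K) (hX : ∀ i, Measurable (X i)) (n : ℕ)
    (x : EuclideanSpace ℝ (Fin d)) : Measurable (densityEstimator K h X n x) := by
  refine (Finset.measurable_fun_sum _ fun i _ => hK.comp ?_).const_mul _
  exact ((hX i).const_sub x).const_smul (h n)⁻¹

lemma measurable_numeratorEstimator (hK : Measurable K) (hX : ∀ i, Measurable (X i))
    (hY : ∀ i, Measurable (Y i)) (n : ℕ) (x : EuclideanSpace ℝ (Fin d)) :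
    Measurable (numeratorEstimator K h X Y n x) := by
  have hterm : ∀ i, Measurable fun ω => K ((h n)⁻¹ • (x - X i ω)) • Y i ω := fun i =>
    Measurable.smul (hK.comp (((hX i).const_sub x).const_smul (h n)⁻¹)) (hY i)
  exact Measurable.const_smul (Finset.measurable_fun_sum _ fun i _ => hterm i) ((n : ℝ) * h n ^ d)⁻¹

/-- If the density estimator is uniformly superexponentially close to `g ≠ 0`, then
`v (r_n - r)` is a superexponentially good rescaling of the linearised estimator. -/
lemma isSuperexponentialRescaling_nadarayaWatson {P : Measure Ω} [IsFiniteMeasure P]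
    {x : EuclideanSpace ℝ (Fin d)} {v ν : ℕ → ℝ} {g : ℝ} (hg : 0 < g)
    (r : EuclideanSpace ℝ (Fin q))
    (hdens : ∀ η : ℝ, 0 < η → ∀ M : ℝ, ∀ᶠ n in atTop,
      P.real {ω | η < |densityEstimator K h X n x ω - g|} ≤ Real.exp (-(ν n * M))) :
    IsSuperexponentialRescaling P
      (fun n ω => (v n / g) •
        (numeratorEstimator K h X Y n x ω - densityEstimator K h X n x ω • r))
      (fun n ω => v n • (nadarayaWatson K h X Y n x ω - r)) ν := by
  intro δ hδ M
  -- The first bound keeps `g_n ≥ g / 2 > 0`, hence in the nondegenerate branch. The second then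
  -- gives `|g / g_n - 1| = |g_n - g| / g_n ≤ δ`.
  set η : ℝ := min (g / 2) (g / 2 * δ) with hη
  have hη0 : 0 < η := by positivity
  filter_upwards [hdens η hη0 M] with n hn
  refine (measureReal_mono (fun ω hω => ?_)).trans hn
  rw [Set.mem_ofPred_eq] at hω ⊢
  by_contra! hcon
  refine hω ⟨g / densityEstimator K h X n x ω, ?_, ?_⟩
  all_goals
    have h1 : |densityEstimator K h X n x ω - g| ≤ g / 2 := hcon.trans (min_le_left _ _)
    have h2 : |densityEstimator K h X n x ω - g| ≤ g / 2 * δ := hcon.trans (min_le_right _ _)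
    have h3 : g / 2 ≤ densityEstimator K h X n x ω := by linarith [(abs_le.1 h1).1]
    have hpos : 0 < densityEstimator K h X n x ω := by linarith
  · have : g / densityEstimator K h X n x ω - 1 =
        -(densityEstimator K h X n x ω - g) / densityEstimator K h X n x ω := by
      field_simp; ring
    rw [this, abs_div, abs_neg, abs_of_pos hpos, div_le_iff₀ hpos]
    nlinarith
  · have : nadarayaWatson K h X Y n x ω =
        (densityEstimator K h X n x ω)⁻¹ • numeratorEstimator K h X Y n x ω := by
      rw [nadarayaWatson, if_pos hpos.ne']
    rw [this, smul_smul]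
    have e1 : g / densityEstimator K h X n x ω * (v n / g) =
        v n * (densityEstimator K h X n x ω)⁻¹ := by field_simp
    rw [e1, mul_smul, smul_sub (densityEstimator K h X n x ω)⁻¹, smul_smul _ _ r,
      inv_mul_cancel₀ hpos.ne', one_smul]

end Estimators

/-! ### Assembly of the main theorem. -/

theorem theorem2 {Ω : Type*} [MeasurableSpace Ω] (P : Measure Ω) [IsProbabilityMeasure P]
    (d q : ℕ) (hd : 1 ≤ d)
    -- the i.i.d. sample, with joint density `f`
    (X : ℕ → Ω → EuclideanSpace ℝ (Fin d)) (Y : ℕ → Ω → EuclideanSpace ℝ (Fin q))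
    (hX : ∀ i, Measurable (X i)) (hY : ∀ i, Measurable (Y i))
    (f : EuclideanSpace ℝ (Fin d) → EuclideanSpace ℝ (Fin q) → ℝ)
    (hf_meas : Measurable (Function.uncurry f)) (hf_nonneg : ∀ t y, 0 ≤ f t y)
    (hlaw : ∀ i, P.map (fun ω => (X i ω, Y i ω)) =
      (volume : Measure (EuclideanSpace ℝ (Fin d) × EuclideanSpace ℝ (Fin q))).withDensity
        (fun z => ENNReal.ofReal (f z.1 z.2)))
    (hindep : iIndepFun (fun i ω => (X i ω, Y i ω)) P)
    (hYint : ∀ i, Integrable (Y i) P)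
    -- the kernel, the bandwidth, the normalizing sequence, the point
    (K : EuclideanSpace ℝ (Fin d) → ℝ) (hK_meas : Measurable K)
    (h : ℕ → ℝ) (hh_pos : ∀ n, 1 ≤ n → 0 < h n) (hh_zero : Tendsto h atTop (𝓝 0))
    (hh_inf : Tendsto (fun n : ℕ => (n : ℝ) * h n ^ d) atTop atTop)
    (v : ℕ → ℝ) (hv_pos : ∀ n, 1 ≤ n → 0 < v n)
    (x : EuclideanSpace ℝ (Fin d))
    -- (A1)
    (hK_bdd : ∃ C : ℝ, ∀ z, |K z| ≤ C) (hK_int : Integrable K) (hK_one : ∫ z, K z = 1)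
    (hK_lim : Tendsto K (cocompact (EuclideanSpace ℝ (Fin d))) (𝓝 0))
    -- (A2)
    (hA2_fin : ∀ (u : EuclideanSpace ℝ (Fin q)) (t : EuclideanSpace ℝ (Fin d)),
      Integrable (fun y => Real.exp (inner ℝ u y) * f t y))
    (hA2_cont : ∀ u : EuclideanSpace ℝ (Fin q),
      ContinuousAt (fun t => ∫ y, Real.exp (inner ℝ u y) * f t y) x)
    (hA2_bdd : ∀ u : EuclideanSpace ℝ (Fin q), ∃ C : ℝ, ∀ t : EuclideanSpace ℝ (Fin d),
      ∫ y, Real.exp (inner ℝ u y) * f t y ≤ C)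
    -- (A3)
    (hA3_sq : ∀ u : EuclideanSpace ℝ (Fin q),
      ContinuousAt (fun t => ∫ y, inner ℝ u y ^ 2 * f t y) x)
    (hA3_lin : ∀ u : EuclideanSpace ℝ (Fin q),
      ContinuousAt (fun t => ∫ y, inner ℝ u y * f t y) x)
    (hA3_g : marginalDensity f x ≠ 0)
    -- (A4)
    (hA4_v : Tendsto v atTop atTop)
    (hA4_speed : Tendsto (fun n : ℕ => (n : ℝ) * h n ^ d / v n ^ 2) atTop atTop)
    -- (A5)
    (p : ℕ) (hp : 2 ≤ p) (hA5_K : HasKernelOrder K p)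
    (hA5_bias : Tendsto (fun n => v n * h n ^ p) atTop (𝓝 0))
    (hA5_m : HasBoundedDifferential (unnormalizedRegression f) p x)
    (hA5_g : HasBoundedDifferential (marginalDensity f) p x) :
    IsGoodRateFunction (quadraticRate K f x) ∧
    SatisfiesLDP P (fun n ω => v n • (nadarayaWatson K h X Y n x ω - regression f x))
      (fun n : ℕ => (n : ℝ) * h n ^ d / v n ^ 2) (quadraticRate K f x) := by
  obtain ⟨CK, hCK⟩ := hK_bdd
  have hd0 : d ≠ 0 := by omega
  have hexp := isBoundedlyIntegrable_exp_abs_affine hf_meas hf_nonneg hA2_fin hA2_bdd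
  have hpow := isBoundedlyIntegrable_affine_pow hf_meas hf_nonneg hexp
  have haff : ∀ (a : ℝ) (u : EuclideanSpace ℝ (Fin q)),
      IsBoundedlyIntegrable f fun y => a + inner ℝ u y := fun a u => by simpa using hpow 1 a u
  have hint0 : ∀ t, Integrable (f t) := fun t => by simpa using (haff 1 0).integrable t
  have hint1 := integrable_smul_id hf_meas hpow
  have hgpos : 0 < marginalDensity f x :=
    lt_of_le_of_ne (integral_nonneg (hf_nonneg x)) hA3_g.symm
  set g := marginalDensity f x with hg
  set r := regression f x with hr
  have hS : (condCovariance f x).PosDef := condCovariance_posDef hf_meas hf_nonneg hpow hA3_g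
  have hK2int : Integrable fun z => K z ^ 2 := by
    refine (hK_int.mul_bdd (c := CK) hK_int.aestronglyMeasurable
      (ae_of_all _ fun z => hCK z)).congr (ae_of_all _ fun z => ?_)
    simp only [sq]
  -- Otherwise `K` would vanish almost everywhere, against `∫ K = 1`.
  have hK2 : 0 < ∫ z, K z ^ 2 := by
    refine lt_of_le_of_ne (integral_nonneg fun z => sq_nonneg (K z)) fun h0 => ?_
    have hae := (integral_eq_zero_iff_of_nonneg (fun z => sq_nonneg (K z)) hK2int).1 h0.symm
    have hK0 : ∫ z, K z = 0 := by
      refine integral_eq_zero_of_ae ?_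
      filter_upwards [hae] with z hz
      simpa using hz
    rw [hK0] at hK_one
    exact zero_ne_one hK_one
  have hc : 0 < (∫ z, K z ^ 2) / g := div_pos hK2 hgpos
  have hrate : quadraticRate K f x = fun w => ENNReal.ofReal ((2 * ((∫ z, K z ^ 2) / g))⁻¹ *
      (w.ofLp ⬝ᵥ ((condCovariance f x)⁻¹ *ᵥ w.ofLp))) := by
    funext w
    rw [quadraticRate, ← hg]
    congr 2
    field_simp
  have hspeed : IsSpeed fun n : ℕ => (n : ℝ) * h n ^ d / v n ^ 2 := by
    refine ⟨fun n hn => ?_, hA4_speed⟩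
    have h1 := hh_pos n hn
    have h2 := hv_pos n hn
    have h3 : (0 : ℝ) < n := by exact_mod_cast hn
    positivity
  have hVcont : ∀ (a : ℝ) (u : EuclideanSpace ℝ (Fin q)),
      ContinuousAt (fun t => ∫ y, (a + inner ℝ u y) ^ 2 * f t y) x := by
    intro a u
    have hgc : ContinuousAt (fun t => ∫ y, f t y) x := by simpa using hA2_cont 0
    have heq : (fun t => ∫ y, (a + inner ℝ u y) ^ 2 * f t y) = fun t =>
        a ^ 2 * (∫ y, f t y) + 2 * a * (∫ y, inner ℝ u y * f t y) +
          ∫ y, inner ℝ u y ^ 2 * f t y := by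
      funext t
      have i1 : Integrable fun y => inner ℝ u y * f t y := by simpa using (haff 0 u).integrable t
      have i2 : Integrable fun y => inner ℝ u y ^ 2 * f t y := by
        simpa using (hpow 2 0 u).integrable t
      rw [← integral_const_mul, ← integral_const_mul,
        ← integral_add ((hint0 t).const_mul _) (i1.const_mul _),
        ← integral_add (f := fun y => a ^ 2 * f t y + 2 * a * (inner ℝ u y * f t y))
          (((hint0 t).const_mul _).add (i1.const_mul _)) i2]
      congr 1; funext y; ring
    rw [heq]
    exact ((hgc.const_mul _).add ((hA3_lin u).const_mul _)).add (hA3_sq u)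
  -- One affine family serves twice: `u = 0` with `a = ±1` for the density estimator, and `a = -⟪u,
  -- r⟫` for the linearised error.
  have hmgf := fun (a : ℝ) (u : EuclideanSpace ℝ (Fin q)) {ε : ℝ} (hε : 0 < ε) =>
    eventually_mgf_kernelSum_bounds (P := P) hd0 hX hY hf_meas hf_nonneg hlaw hindep hK_meas hK_int
      hCK hh_pos hh_zero hA4_v (ψ := fun y => a + inner ℝ u y) (haff a u).measurable
      (fun c hc => hexp a c hc u) (hpow 2 a u) (hVcont a u)
      (tendsto_bias_affine hf_meas hf_nonneg haff hint1 hK_meas hK_int hK_one (by omega) hA5_K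
        hA5_m hA5_g hA5_bias a u) hε
  have htail : ∀ a : ℝ, ∀ η : ℝ, 0 < η → ∀ M : ℝ, ∀ᶠ n : ℕ in atTop,
      P.real {ω | η < a * (densityEstimator K h X n x ω - g)} ≤
        Real.exp (-((n : ℝ) * h n ^ d / v n ^ 2 * M)) := by
    intro a η hη M
    -- On the moderate scale a fixed deviation `η` becomes `v n * η → ∞`, so Chernoff with unit tilt
    -- beats every rate `M`.
    have hη' : Tendsto (fun n => v n * η) atTop atTop := hA4_v.atTop_mul_const hη
    filter_upwards [hmgf a 0 zero_lt_one, hη'.eventually_ge_atTop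
      (M + ((∫ z, K z ^ 2) * (∫ y, (a + inner ℝ (0 : EuclideanSpace ℝ (Fin q)) y) ^ 2 * f x y) / 2
        + 1)), eventually_ge_atTop 1] with n hn hvn hn1
    have hνpos := hspeed.1 n hn1
    have hvpos := hv_pos n hn1
    obtain ⟨hi, -, hup⟩ := hn
    have hTeq : ∀ ω, v n / (n * h n ^ d) * (∑ i ∈ Finset.range n, K ((h n)⁻¹ • (x - X i ω)) *
          (a + inner ℝ (0 : EuclideanSpace ℝ (Fin q)) (Y i ω)))
          - v n * ∫ y, (a + inner ℝ (0 : EuclideanSpace ℝ (Fin q)) y) * f x y =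
        v n * (a * (densityEstimator K h X n x ω - g)) := by
      intro ω
      simp only [inner_zero_left, add_zero, ← Finset.sum_mul, integral_const_mul, densityEstimator]
      rw [hg, marginalDensity]
      ring
    simp only [hTeq] at hi hup
    have hcher := measure_ge_le_exp_mul_mgf (μ := P)
      (X := fun ω => v n * (a * (densityEstimator K h X n x ω - g))) (v n * η) hνpos.le hi
    calc _ ≤ P.real {ω | v n * η ≤ v n * (a * (densityEstimator K h X n x ω - g))} :=
          measureReal_mono (Set.ofPred_subset_ofPred.2 fun ω hω =>
            mul_le_mul_of_nonneg_left (le_of_lt hω) hvpos.le)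
      _ ≤ _ := hcher
      _ ≤ _ := mul_le_mul_of_nonneg_left hup (Real.exp_pos _).le
      _ ≤ _ := by
        rw [← Real.exp_add]
        refine Real.exp_le_exp.2 ?_
        nlinarith
  have hdens : ∀ η : ℝ, 0 < η → ∀ M : ℝ, ∀ᶠ n : ℕ in atTop,
      P.real {ω | η < |densityEstimator K h X n x ω - g|} ≤
        Real.exp (-((n : ℝ) * h n ^ d / v n ^ 2 * M)) := by
    intro η hη M
    filter_upwards [htail 1 η hη (M + 1), htail (-1) η hη (M + 1),
      eventually_const_mul_exp_le hA4_speed 2 (show M < M + 1 by linarith)] with n h1 h2 h3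
    calc _ ≤ P.real ({ω | η < 1 * (densityEstimator K h X n x ω - g)} ∪
          {ω | η < -1 * (densityEstimator K h X n x ω - g)}) := by
          refine measureReal_mono (fun ω hω => ?_)
          rcases lt_abs.1 (show η < |densityEstimator K h X n x ω - g| from hω) with h | h
          · exact Or.inl (show η < 1 * _ by linarith)
          · exact Or.inr (show η < -1 * _ by linarith)
      _ ≤ _ := measureReal_union_le _ _
      _ ≤ _ := by linarith
  have hL : HasScaledLogMGF P (fun n ω => (v n / g) •
      (numeratorEstimator K h X Y n x ω - densityEstimator K h X n x ω • r))
      (fun n : ℕ => (n : ℝ) * h n ^ d / v n ^ 2)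
      (fun u => (∫ z, K z ^ 2) / g / 2 * (u.ofLp ⬝ᵥ (condCovariance f x *ᵥ u.ofLp))) := by
    intro u ε hε
    -- Centring at the conditional mean `r` makes the subtracted mean zero and turns the second
    -- moment into `g` times a conditional variance. The rescaling `g⁻¹ • u` accounts for the factor
    -- `v n / g`.
    have hcentre : ∫ y, (-inner ℝ (g⁻¹ • u) r + inner ℝ (g⁻¹ • u) y) * f x y = 0 := by
      rw [integral_affine_mul hint0 hint1, ← hg, hr, regression, ← hg]
      simp only [real_inner_smul_left, real_inner_smul_right]
      field_simp
      ring
    have hvar : (∫ z, K z ^ 2) *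
        (∫ y, (-inner ℝ (g⁻¹ • u) r + inner ℝ (g⁻¹ • u) y) ^ 2 * f x y) / 2 =
        (∫ z, K z ^ 2) / g / 2 * (u.ofLp ⬝ᵥ (condCovariance f x *ᵥ u.ofLp)) := by
      have h1 := dotProduct_condCovariance_mulVec hf_meas hf_nonneg hpow x (g⁻¹ • u)
      rw [← hr, ← hg, eq_div_iff hgpos.ne'] at h1
      rw [← h1]
      simp only [WithLp.ofLp_smul, Matrix.mulVec_smul, dotProduct_smul, smul_dotProduct,
        smul_eq_mul]
      field_simp
    filter_upwards [hmgf (-inner ℝ (g⁻¹ • u) r) (g⁻¹ • u) hε] with n hn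
    have hTeq : ∀ ω, v n / (n * h n ^ d) * (∑ i ∈ Finset.range n, K ((h n)⁻¹ • (x - X i ω)) *
          (-inner ℝ (g⁻¹ • u) r + inner ℝ (g⁻¹ • u) (Y i ω))) - v n * 0 =
        inner ℝ u ((v n / g) •
          (numeratorEstimator K h X Y n x ω - densityEstimator K h X n x ω • r)) := by
      intro ω
      have h1 := inner_numeratorEstimator_sub (K := K) (h := h) (X := X) (Y := Y) n x ω (g⁻¹ • u) r
      rw [real_inner_smul_left] at h1
      calc _ = v n * (((n : ℝ) * h n ^ d)⁻¹ * ∑ i ∈ Finset.range n, K ((h n)⁻¹ • (x - X i ω)) *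
            (-inner ℝ (g⁻¹ • u) r + inner ℝ (g⁻¹ • u) (Y i ω))) := by ring
        _ = _ := by rw [← h1, real_inner_smul_right]; ring
    rw [hcentre, hvar] at hn
    simp only [hTeq] at hn
    exact hn
  rw [hrate]
  refine ⟨isGoodRateFunction_quadratic hS hc, satisfiesLDP_quadratic hS hc hspeed (fun n => ?_) hL
    (isSuperexponentialRescaling_nadarayaWatson hgpos r hdens)⟩
  exact Measurable.const_smul ((measurable_numeratorEstimator hK_meas hX hY n x).sub
    ((measurable_densityEstimator hK_meas hX n x).smul_const r)) (v n / g)
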